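/- Setting. Let $\mathcal H$ be a complex Hilbert space, $\mathcal A\subset B(\mathcal H)$ a unital $*$-subalgebra containing the identity operator, and $\mathcal D$ a densely defined selfadjoint operator on $\mathcal H$ such that $\langle\mathcal D\rangle^{-1}:=(1+\mathcal D^2)^{-1/2}$ is compact and, for each $a\in\mathcal A$, $a(\operatorname{Dom}\mathcal D)\subseteq\operatorname{Dom}\mathcal D$ and $[\mathcal D,a]$ extends to a bounded operator (a spectral triple). Let $\mathcal C=C_{\mathcal D}(\mathcal A)\subset B(\mathcal H)$ be the $*$-algebra generated by $\mathcal A$ and $\{[\mathcal D,a]:a\in\mathcal A\}$, and let $\mathcal H_\infty=\bigcap_k\operatorname{Dom}\mathcal D^k$. Assume: 1. (Regularity) $\mathcal A$ and $[\mathcal D,\mathcal A]$ lie in $\bigcap_m\operatorname{Dom}\delta^m$, where $\delta=[|\mathcal D|,\cdot\,]$. 2. (Dimension) For a positive integer $p$, $\langle\mathcal D\rangle^{-p}$ lies in the Dixmier ideal $\mathcal L^{1,\infty}$, i.e. it is compact and the sum of its first $N$ singular values is $O(\log N)$. Fix a Dixmier limit $\omega$ (a positive linear functional on bounded real sequences extending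 the limit and invariant under $(x_0,x_1,\dots)\mapsto(x_0,x_0,x_1,x_1,\dots)$), let $\operatorname{Tr}_\omega$ be the Dixmier trace and $\psi_\omega(w)=\operatorname{Tr}_\omega(w\langle\mathcal D\rangle^{-p})$ for $w\in\mathcal C$. 3. (Orientability) $\mathbf c=\sum_\alpha a^0_\alpha\otimes a^1_\alpha\otimes\cdots\otimes a^p_\alpha$ is a Hochschild $p$-cycle of $\mathcal A$ with coefficients in $\mathcal A$ such that $C:=\sum_\alpha a^0_\alpha[\mathcal D,a^1_\alpha]\cdots[\mathcal D,a^p_\alpha]$ satisfies $C=C^*$, $C^2=1$, $C\mathcal D=(-1)^{p-1}\mathcal D C$, and $Ca=aC$ for all $a\in\mathcal A$. 4. (Riemannian condition) There are a unit vector $\Phi\in\mathcal H_\infty$, a left hermitian pairing ${}_{\mathcal C}(\cdot|\cdot)$ on $\mathcal H_\infty$ with values in $\mathcal C$, and a selfadjoint unitary $\varepsilon$ on $\mathcal H$ such that: $\mathcal H_\infty=\{w\Phi:w\in\mathcal C\}$; for $w\in\mathcal C$, $w\Phi=0$ implies $w=0$; $\langle\eta|\xi\rangle=\psi_\omega({}_{\mathcal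 C}(\xi|\eta))$ for $\xi,\eta\in\mathcal H_\infty$; $z={}_{\mathcal C}(\Phi|\Phi)$ is central in $\mathcal C$ and strictly positive (positive, and invertible in the $C^*$-closure of $\mathcal C$); $\mathcal H_\infty$ is finitely generated and projective as a left $\mathcal A$-module; $\varepsilon$ commutes with $\mathcal A$ and anticommutes with $\mathcal D$; and $\varepsilon\Phi=\Phi$. Here a left hermitian pairing on a left $\mathcal C$-module is a pairing that is linear in the first entry, satisfies ${}_{\mathcal C}(\xi|\eta)^*={}_{\mathcal C}(\eta|\xi)$ and ${}_{\mathcal C}(u\xi|v\eta)=u\,{}_{\mathcal C}(\xi|\eta)\,v^*$, and is positive definite; right hermitian pairings on right modules are defined likewise, being linear in the second entry with $(\xi u|\eta v)_{\mathcal C}=u^*(\xi|\eta)_{\mathcal C}\,v$. A pairing is full if the linear span of its values is norm dense in $\mathcal C$. A pre-Morita equivalence bimodule between $\mathcal C$ and itself is a $\mathcal C$-$\mathcal C$-bimodule with full left and right hermitian pairings such that ${}_{\mathcal C}(ea|ea)\le\|a\|^2{}_{\mathcal C}(e|e)$, $(be|be)_{\mathcal C}\le\|b\|^2(e|e)_{\mathcal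 C}$ and ${}_{\mathcal C}(e|f)\,g=e\,(f|g)_{\mathcal C}$ for all $a,b\in\mathcal C$ and all $e,f,g$ in the module. Statement. There is a unique antiunitary operator $J$ on $\mathcal H$ with $J(T\Phi)=T^*\Phi$ for all $T$ in the double commutant $\mathcal C''$ (the Tomita conjugation). Write $w^{\mathrm{op}}:=Jw^*J$. Then (a) $J\varepsilon=\varepsilon J$; (b) if $p$ is even, $\varepsilon=CJCJ=CC^{\mathrm{op}}$; (c) if $p$ is odd, $\varepsilon C=-C\varepsilon$ and $C=JCJ=C^{\mathrm{op}}$; (d) $J$ maps $\mathcal H_\infty$ bijectively onto $\mathcal H_\infty$; (e) with its given left action and left pairing, the right action $\xi\cdot w:=w^{\mathrm{op}}\xi$, and the right pairing $(\xi|\eta)_{\mathcal C}:={}_{\mathcal C}(J\xi|J\eta)$, $\mathcal H_\infty$ is a pre-Morita equivalence bimodule between $\mathcal C$ and itself. -/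

import Mathlib

open scoped ComplexOrder InnerProductSpace

noncomputable section

namespace NCG

/-! ### Unbounded operators and the functional calculus of a selfadjoint operator -/

section Unbounded

variable {H : Type*} [NormedAddCommGroup H] [InnerProductSpace ℂ H] [CompleteSpace H]

/-- `Dom (D ^ k)`. -/
def domPow (D : H →ₗ.[ℂ] H) : ℕ → Submodule ℂ H
  | 0 => ⊤
  | k + 1 => ((domPow D k).comap D.toFun).map D.domain.subtype

/-- The smooth domain `⋂ k, Dom (D ^ k)`. -/
def smoothDom (D : H →ₗ.[ℂ] H) : Submodule ℂ H := ⨅ k, domPow D k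

/-- `T` maps `Dom M` to itself and the commutator `[M, T]` (with domain `Dom M`) extends to the
bounded operator `S`. When `M` is densely defined, `S` is unique. -/
def HasCommutator (M : H →ₗ.[ℂ] H) (T S : H →L[ℂ] H) : Prop :=
  ∀ x : M.domain, ∃ h : T x ∈ M.domain, M ⟨T x, h⟩ - T (M x) = S x

open Classical in
/-- The bounded extension of `[M, T]`, for those `T` for which it exists (and `0` otherwise). -/
def commutator (M : H →ₗ.[ℂ] H) (T : H →L[ℂ] H) : H →L[ℂ] H :=
  if h : ∃ S, HasCommutator M T S then h.choose else 0

/-- `T` belongs to the domain of the `m`-th power of the derivation `δ = [M, ·]`. -/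
def InDomDerivPow (M : H →ₗ.[ℂ] H) : ℕ → (H →L[ℂ] H) → Prop
  | 0, _ => True
  | m + 1, T => ∃ S, HasCommutator M T S ∧ InDomDerivPow M m S

/-- The graph of `D` in the Hilbert space direct sum `H ⊕ H`. -/
def graphL2 (D : H →ₗ.[ℂ] H) : Submodule ℂ (WithLp 2 (H × H)) :=
  D.graph.comap (WithLp.linearEquiv 2 ℂ (H × H)).toLinearMap

/-- The bounded operator `(1 + D ^ 2)⁻¹` of a selfadjoint operator `D`. By von Neumann's
construction, `(1 + D ^ 2)⁻¹ f` is the first component of the orthogonal projection of `(f, 0)`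
onto the (closed) graph of `D`: if that projection is `(u, D u)`, then `(f - u, - D u)` is
orthogonal to the graph, that is, `D u ∈ Dom D` and `D (D u) = f - u`.
See `resolventSq_spec` below. -/
def resolventSq (D : H →ₗ.[ℂ] H) : H →L[ℂ] H :=
  (ContinuousLinearMap.fst ℂ H H) ∘L
    (WithLp.prodContinuousLinearEquiv 2 ℂ H H : WithLp 2 (H × H) →L[ℂ] H × H) ∘L
    (graphL2 D).topologicalClosure.starProjection ∘L
    ((WithLp.prodContinuousLinearEquiv 2 ℂ H H).symm : H × H →L[ℂ] WithLp 2 (H × H)) ∘L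
    (ContinuousLinearMap.inl ℂ H H)

theorem resolventSq_spec {D : H →ₗ.[ℂ] H} (hD : IsSelfAdjoint D) (f : H) :
    ∃ (h : resolventSq D f ∈ D.domain) (h' : D ⟨resolventSq D f, h⟩ ∈ D.domain),
      resolventSq D f + D ⟨D ⟨resolventSq D f, h⟩, h'⟩ = f := by
  have hdense := hD.dense_domain
  have hcl : IsClosed (D.graph : Set (H × H)) := hD.isClosed
  have hclosed : (graphL2 D).topologicalClosure = graphL2 D :=
    IsClosed.submodule_topologicalClosure_eq
      (hcl.preimage (WithLp.prodContinuousLinearEquiv 2 ℂ H H).continuous)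
  set v : WithLp 2 (H × H) := WithLp.toLp 2 (f, 0) with hv
  have hmem := Submodule.starProjection_apply_mem (graphL2 D).topologicalClosure v
  have horth := Submodule.sub_starProjection_mem_orthogonal
    (K := (graphL2 D).topologicalClosure) v
  set w := (graphL2 D).topologicalClosure.starProjection v with hw
  have hR : resolventSq D f = w.fst := rfl
  rw [hclosed] at hmem
  obtain ⟨y, hy1, hy2⟩ := D.mem_graph_iff.1 (show (w.fst, w.snd) ∈ D.graph from hmem)
  have h : resolventSq D f ∈ D.domain := by
    rw [hR]
    exact (show (y : H) = w.fst from hy1) ▸ y.2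
  have hyeq : (⟨resolventSq D f, h⟩ : D.domain) = y := Subtype.ext (hR.trans hy1.symm)
  have key : ∀ x : D.domain, inner ℂ (f - w.fst) (x : H) = inner ℂ (D y) (D x) := by
    intro x
    have hx : (WithLp.toLp 2 ((x : H), D x) : WithLp 2 (H × H)) ∈
        (graphL2 D).topologicalClosure := by
      rw [hclosed]; exact D.mem_graph x
    have := Submodule.inner_left_of_mem_orthogonal hx horth
    rw [WithLp.prod_inner_apply] at this
    simp [hv] at this
    rw [hy2]
    linear_combination this
  have hy : D y ∈ D.domain := by
    have : D y ∈ D.adjoint.domain :=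
      LinearPMap.mem_adjoint_domain_of_exists _ ⟨_, key⟩
    rwa [show D.adjoint = D from hD] at this
  refine ⟨h, by rw [hyeq]; exact hy, ?_⟩
  have h3 : ∀ (z : D.domain), (z : H) = D y → D z = f - w.fst := by
    intro z hz
    have hz' : (z : H) ∈ D.adjoint.domain := by
      rw [show D.adjoint = D from hD]; exact z.2
    have e := LinearPMap.adjoint_apply_eq hdense ⟨z, hz'⟩ (x₀ := f - w.fst)
      (fun x => by rw [key x, hz])
    have hle : D ≤ D.adjoint := le_of_eq (show D.adjoint = D from hD).symm
    rw [← e]; exact hle.2 rfl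
  rw [h3 _ (by simp only [hyeq]), hR]
  abel

/-- The bounded operator `⟨D⟩⁻¹ = (1 + D ^ 2) ^ (-1/2)`. -/
def regInv (D : H →ₗ.[ℂ] H) : H →L[ℂ] H := CFC.sqrt (resolventSq D)

/-- The modulus `|D| = (1 - (1 + D ^ 2)⁻¹) ^ (1/2) ⟨D⟩`, with domain
`range ⟨D⟩⁻¹ = Dom |D| = Dom D`. -/
def absOp (D : H →ₗ.[ℂ] H) : H →ₗ.[ℂ] H :=
  (CFC.sqrt (1 - resolventSq D) : H →L[ℂ] H).toLinearMap.compPMap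
    ((regInv D).toLinearMap.toPMap ⊤).inverse

end Unbounded

/-! ### The Dixmier ideal and Dixmier traces -/

section Dixmier

variable {H : Type*} [NormedAddCommGroup H] [InnerProductSpace ℂ H] [CompleteSpace H]

/-- The `n`-th singular value (counted from `0`) of a compact operator: its distance to the
operators of rank at most `n`. -/
def singularValue (T : H →L[ℂ] H) (n : ℕ) : ℝ :=
  sInf {r | ∃ F : H →L[ℂ] H, LinearMap.rank (F : H →ₗ[ℂ] H) ≤ (n : Cardinal) ∧ r = ‖T - F‖}

/-- The logarithmic means `(∑ k ≤ n, μ k (T)) / log (n + 2)`. -/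
def logMean (T : H →L[ℂ] H) (n : ℕ) : ℝ :=
  (∑ k ∈ Finset.range (n + 1), singularValue T k) / Real.log (n + 2)

/-- Membership in the Dixmier ideal `𝓛^(1,∞)`: `T` is compact and
`∑ k ≤ n, μ k (T) = O(log n)`. -/
def InDixmierIdeal (T : H →L[ℂ] H) : Prop :=
  IsCompactOperator T ∧ ∃ K : ℝ, ∀ n, logMean T n ≤ K

/-- A Dixmier limit: a positive linear functional on the bounded real sequences that extends the
limit of convergent sequences and is invariant under the dilation
`(x₀, x₁, x₂, …) ↦ (x₀, x₀, x₁, x₁, x₂, x₂, …)`. -/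
structure DixmierLimit where
  toFun : BoundedContinuousFunction ℕ ℝ →ₗ[ℝ] ℝ
  nonneg : ∀ x, (∀ n, 0 ≤ x n) → 0 ≤ toFun x
  eq_lim : ∀ x l, Filter.Tendsto (fun n => x n) Filter.atTop (nhds l) → toFun x = l
  dilation : ∀ x y, (∀ n, y n = x (n / 2)) → toFun y = toFun x

open Classical in
/-- The Dixmier trace of a positive operator in the Dixmier ideal. -/
def DixmierLimit.tracePos (ω : DixmierLimit) (T : H →L[ℂ] H) : ℝ :=
  if h : ∃ K : ℝ, ∀ n, ‖logMean T n‖ ≤ K then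
    ω.toFun (BoundedContinuousFunction.ofNormedAddCommGroupDiscrete (logMean T) h.choose
      h.choose_spec)
  else 0

/-- The Dixmier trace on the Dixmier ideal: the linear extension from the positive operators, by
means of the positive and negative parts of the real and imaginary parts. -/
def DixmierLimit.trace (ω : DixmierLimit) (T : H →L[ℂ] H) : ℂ :=
  ((ω.tracePos (realPart T : H →L[ℂ] H)⁺ - ω.tracePos (realPart T : H →L[ℂ] H)⁻ : ℝ) : ℂ) +
    Complex.I *
      ((ω.tracePos (imaginaryPart T : H →L[ℂ] H)⁺
        - ω.tracePos (imaginaryPart T : H →L[ℂ] H)⁻ : ℝ) : ℂ)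

end Dixmier

/-! ### Hermitian modules and pre-Morita equivalence bimodules

`𝓐`, `𝓑` are `*`-subalgebras of C*-algebras `A`, `B`; they are dense in their norm closures, and
norms and positivity in the closures are those of `A` and `B`. -/

section Modules

variable {A : Type*} [CStarAlgebra A] [PartialOrder A] [StarOrderedRing A]
variable {B : Type*} [CStarAlgebra B] [PartialOrder B] [StarOrderedRing B]
variable {E : Type*} [AddCommGroup E] [Module ℂ E]

/-- `pair` is a left hermitian pairing on the left `𝓑`-module `E`. -/
structure IsLeftHermitian (𝓑 : StarSubalgebra ℂ B) (lact : 𝓑 →ₐ[ℂ] Module.End ℂ E)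
    (pair : E → E → 𝓑) : Prop where
  add_left : ∀ e e' f, pair (e + e') f = pair e f + pair e' f
  smul_left : ∀ (c : ℂ) e f, pair (c • e) f = c • pair e f
  star_pair : ∀ e f, star (pair e f) = pair f e
  act : ∀ a b e f, pair (lact a e) (lact b f) = a * pair e f * star b
  nonneg : ∀ e, (0 : B) ≤ pair e e
  definite : ∀ e, pair e e = 0 → e = 0

/-- `pair` is a right hermitian pairing on the right `𝓐`-module `E`. -/
structure IsRightHermitian (𝓐 : StarSubalgebra ℂ A) (ract : 𝓐ᵐᵒᵖ →ₐ[ℂ] Module.End ℂ E)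
    (pair : E → E → 𝓐) : Prop where
  add_right : ∀ e f f', pair e (f + f') = pair e f + pair e f'
  smul_right : ∀ (c : ℂ) e f, pair e (c • f) = c • pair e f
  star_pair : ∀ e f, star (pair e f) = pair f e
  act : ∀ a b e f, pair (ract (.op b) e) (ract (.op a) f) = star b * pair e f * a
  nonneg : ∀ e, (0 : A) ≤ pair e e
  definite : ∀ e, pair e e = 0 → e = 0

/-- The linear span of the values of the pairing is norm dense in `𝓐`. -/
def IsFull (𝓐 : StarSubalgebra ℂ A) (pair : E → E → 𝓐) : Prop :=
  Dense (Submodule.span ℂ {a : 𝓐 | ∃ e f, pair e f = a} : Set 𝓐)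

/-- The `𝓑`-`𝓐`-bimodule `E`, with its two pairings, is a pre-Morita equivalence bimodule between
`𝓑` and `𝓐`. -/
structure IsPreMorita (𝓑 : StarSubalgebra ℂ B) (𝓐 : StarSubalgebra ℂ A)
    (lact : 𝓑 →ₐ[ℂ] Module.End ℂ E) (ract : 𝓐ᵐᵒᵖ →ₐ[ℂ] Module.End ℂ E)
    (lpair : E → E → 𝓑) (rpair : E → E → 𝓐) : Prop where
  bimodule : ∀ b a e, lact b (ract (.op a) e) = ract (.op a) (lact b e)
  left_hermitian : IsLeftHermitian 𝓑 lact lpair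
  right_hermitian : IsRightHermitian 𝓐 ract rpair
  left_full : IsFull 𝓑 lpair
  right_full : IsFull 𝓐 rpair
  left_bound : ∀ a e,
    (lpair (ract (.op a) e) (ract (.op a) e) : B) ≤ ‖a‖ ^ 2 • (lpair e e : B)
  right_bound : ∀ b e, (rpair (lact b e) (lact b e) : A) ≤ ‖b‖ ^ 2 • (rpair e e : A)
  compat : ∀ e f g, lact (lpair e f) g = ract (.op (rpair f g)) e

end Modules

/-- A module, given by its action, is finitely generated and projective. -/
def IsFiniteProjective {R E : Type*} [Ring R] [AddCommGroup E] (act : R →+* AddMonoid.End E) :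
    Prop :=
  letI := Module.compHom E act
  Module.Finite R E ∧ Module.Projective R E

/-! ### Hochschild cycles -/

/-- The Hochschild boundary `b (x₀ ⊗ ⋯ ⊗ x_p)`, for `p ≥ 1`. -/
def hochschildBoundary {𝓐 : Type*} [Ring 𝓐] [Algebra ℂ 𝓐] {p : ℕ} (x : Fin (p + 1) → 𝓐) :
    PiTensorProduct ℂ (fun _ : Fin p => 𝓐) :=
  (∑ i : Fin p, (-1 : ℂ) ^ (i : ℕ) •
      PiTensorProduct.tprod ℂ (Fin.contractNth i.castSucc (· * ·) x)) +
    (-1 : ℂ) ^ p • PiTensorProduct.tprod ℂ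
      (fun j : Fin p => if (j : ℕ) = 0 then x (Fin.last p) * x 0 else x j.castSucc)

/-- A Hochschild `p`-cycle `∑ α, a_α⁰ ⊗ a_α¹ ⊗ ⋯ ⊗ a_αᵖ` (for `p ≥ 1`) with coefficients in the
algebra itself. -/
structure HochschildCycle (𝓐 : Type*) [Ring 𝓐] [Algebra ℂ 𝓐] (p : ℕ) where
  n : ℕ
  term : Fin n → Fin (p + 1) → 𝓐
  boundary_eq_zero : ∑ α, hochschildBoundary (term α) = 0

/-! ### Spectral triples -/

section SpectralTriples

variable {H : Type*} [NormedAddCommGroup H] [InnerProductSpace ℂ H] [CompleteSpace H]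

variable (H) in
/-- A spectral triple; the faithfully represented unital `*`-algebra is regarded as a
`*`-subalgebra of the bounded operators on `H`. -/
structure SpectralTriple where
  alg : StarSubalgebra ℂ (H →L[ℂ] H)
  D : H →ₗ.[ℂ] H
  dense_domain : Dense (D.domain : Set H)
  selfAdjoint : IsSelfAdjoint D
  compact_regInv : IsCompactOperator (regInv D)
  exists_commutator : ∀ a ∈ alg, ∃ S, HasCommutator D a S

namespace SpectralTriple

variable (X : SpectralTriple H)

/-- `H_∞ = Dom^∞ D`. -/
def Hinf : Submodule ℂ H := smoothDom X.D

/-- The algebra `C_D(𝓐)` generated by `𝓐` and the operators `[D, a]`, `a ∈ 𝓐`. As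
`[D, a]* = -[D, a*]`, the algebra generated by these operators is a `*`-algebra. -/
def cliff : StarSubalgebra ℂ (H →L[ℂ] H) :=
  StarAlgebra.adjoin ℂ ((X.alg : Set (H →L[ℂ] H)) ∪ commutator X.D '' X.alg)

lemma alg_le_cliff : X.alg ≤ X.cliff := fun _ ha =>
  StarAlgebra.subset_adjoin ℂ _ (Or.inl ha)

/-- Regularity: `𝓐` and `[D, 𝓐]` lie in `Dom^∞ δ`, where `δ = [|D|, ·]`. -/
def IsQCInfty : Prop :=
  ∀ a ∈ X.alg, ∀ m,
    InDomDerivPow (absOp X.D) m a ∧ InDomDerivPow (absOp X.D) m (commutator X.D a)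

/-- `𝓩_p`-summability: `(⟨D⟩⁻¹) ^ p` belongs to the Dixmier ideal. -/
def IsZpSummable (p : ℕ) : Prop := InDixmierIdeal (regInv X.D ^ p)

/-- The functional `ψ_ω(w) = Tr_ω(w ⟨D⟩^(-p))`. -/
def psi (ω : DixmierLimit) (p : ℕ) (w : H →L[ℂ] H) : ℂ := ω.trace (w * regInv X.D ^ p)

/-- `π_D(c) = ∑ α, a_α⁰ [D, a_α¹] ⋯ [D, a_αᵖ]`. -/
def rep {p : ℕ} (c : HochschildCycle X.alg p) : H →L[ℂ] H :=
  ∑ α, (c.term α 0 : H →L[ℂ] H) *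
    (List.ofFn fun i : Fin p => commutator X.D (c.term α i.succ : H →L[ℂ] H)).prod

/-- The orientability condition for the cycle `c`: `C = π_D(c)` is selfadjoint, `C² = 1`,
`C D = (-1)^(p-1) D C`, and `C` commutes with `𝓐`. -/
structure IsOrientation {p : ℕ} (c : HochschildCycle X.alg p) : Prop where
  selfAdjoint : IsSelfAdjoint (X.rep c)
  sq_eq_one : X.rep c * X.rep c = 1
  comm_D : ∀ x : X.D.domain, ∃ h : X.rep c x ∈ X.D.domain,
    X.rep c (X.D x) = (-1 : ℂ) ^ (p + 1) • X.D ⟨X.rep c x, h⟩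
  comm_alg : ∀ a ∈ X.alg, X.rep c * a = a * X.rep c

/-- `ε` is a selfadjoint unitary which commutes with `𝓐` and anticommutes with `D`: it makes the
spectral triple even. -/
structure IsGrading (ε : H →L[ℂ] H) : Prop where
  selfAdjoint : IsSelfAdjoint ε
  sq_eq_one : ε * ε = 1
  comm_alg : ∀ a ∈ X.alg, ε * a = a * ε
  anticomm_D : ∀ x : X.D.domain, ∃ h : ε x ∈ X.D.domain, ε (X.D x) + X.D ⟨ε x, h⟩ = 0

end SpectralTriple

/-- The action on an invariant subspace of a `*`-algebra of operators. -/
def restrictAction (𝓑 : StarSubalgebra ℂ (H →L[ℂ] H)) (E : Submodule ℂ H)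
    (hE : ∀ w ∈ 𝓑, ∀ ξ ∈ E, w ξ ∈ E) : 𝓑 →ₐ[ℂ] Module.End ℂ E where
  toFun w := (w : H →L[ℂ] H).toLinearMap.restrict (hE w w.2)
  map_one' := rfl
  map_mul' _ _ := rfl
  map_zero' := rfl
  map_add' _ _ := rfl
  commutes' _ := rfl

namespace SpectralTriple

variable (X : SpectralTriple H)

/-- `Φ` is cyclic in the algebraic sense: `H_∞ = {w Φ : w ∈ C_D(𝓐)}`. -/
def IsAlgCyclic (Φ : H) : Prop := ∀ ξ, ξ ∈ X.Hinf ↔ ∃ w ∈ X.cliff, w Φ = ξ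

variable {X} in
lemma IsAlgCyclic.invariant {Φ : H} (h : X.IsAlgCyclic Φ) :
    ∀ w ∈ X.cliff, ∀ ξ ∈ X.Hinf, w ξ ∈ X.Hinf := by
  intro w hw ξ hξ
  obtain ⟨u, hu, rfl⟩ := (h ξ).1 hξ
  exact (h _).2 ⟨w * u, mul_mem hw hu, rfl⟩

/-- The Riemannian condition, together with the data that it asserts to exist: the vector `Φ`, the
`C_D(𝓐)`-valued pairing on `H_∞`, and the grading operator `ε`. -/
structure RiemannianStructure (ω : DixmierLimit) (p : ℕ) where
  Φ : X.Hinf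
  norm_Φ : ‖Φ‖ = 1
  cyclic : X.IsAlgCyclic Φ
  separating : ∀ w ∈ X.cliff, w (Φ : H) = 0 → w = 0
  pairing : X.Hinf → X.Hinf → X.cliff
  hermitian : IsLeftHermitian X.cliff (restrictAction X.cliff X.Hinf cyclic.invariant) pairing
  inner_eq : ∀ ξ η : X.Hinf, ⟪(η : H), (ξ : H)⟫_ℂ = X.psi ω p (pairing ξ η)
  strictlyPositive : IsStrictlyPositive (pairing Φ Φ : H →L[ℂ] H)
  central : ∀ w : X.cliff, w * pairing Φ Φ = pairing Φ Φ * w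
  finiteProjective : IsFiniteProjective ((Module.toAddMonoidEnd (Module.End ℂ X.Hinf) X.Hinf).comp
    (restrictAction X.alg X.Hinf
      (fun a ha => cyclic.invariant a (X.alg_le_cliff ha))).toRingHom)
  ε : H →L[ℂ] H
  grading : X.IsGrading ε
  grading_Φ : ε (Φ : H) = Φ

/-- The left action of `C_D(𝓐)` on `H_∞`. -/
def RiemannianStructure.leftAction {X : SpectralTriple H} {ω : DixmierLimit} {p : ℕ}
    (R : X.RiemannianStructure ω p) : X.cliff →ₐ[ℂ] Module.End ℂ X.Hinf :=
  restrictAction X.cliff X.Hinf R.cyclic.invariant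

end SpectralTriple

/-! ### The Tomita conjugation -/

/-- `J` is the Tomita conjugation of the vector `Φ` and the von Neumann algebra `𝓑''`:
`J (T Φ) = T* Φ` for all `T ∈ 𝓑''`. -/
def IsTomita (𝓑 : StarSubalgebra ℂ (H →L[ℂ] H)) (Φ : H) (J : H ≃ₗᵢ⋆[ℂ] H) : Prop :=
  ∀ T ∈ Set.centralizer (Set.centralizer (𝓑 : Set (H →L[ℂ] H))), J (T Φ) = (star T) Φ

/-- The operator `w^op = J w* J`. -/
def opAction (J : H ≃ₗᵢ⋆[ℂ] H) (w : H →L[ℂ] H) : H →L[ℂ] H :=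
  (J : H →L⋆[ℂ] H).comp ((star w : H →L[ℂ] H).comp (J : H →L⋆[ℂ] H))

end SpectralTriples

end NCG

end

/-! The heart of the matter is that w ↦ ⟨Φ|wΦ⟩ is a trace on 𝒞. As ⟨Φ|wΦ⟩ = ψ_ω(wz) with z central,
it is enough that ψ_ω is a trace (`psi_mul_comm`). Write L = ⟨D⟩⁻¹. Two facts are needed: Tr_ω(AT) =
Tr_ω(TA) for A bounded and T in the ideal (`trace_mul_comm`), and Tr_ω kills multiples of [w, L^p].
For the second, regularity bounds [|D|, w] on generators, and |D| differs from ⟨D⟩ by a bounded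
operator, so wL − Lw = L S' L with S' bounded (`exists_mul_regInv_eq`). Hence [w, L^p] is a sum of
terms with p + 1 factors L; the extra factor has singular values tending to 0, so the logarithmic
means vanish in the limit (`logNegligible_pow_mul_pow`). For the first, additivity of the Dixmier
trace has to be proved. Ky Fan's maximum principle bounds the singular sums of S + T above by those
of S and T, and below after doubling the number of terms; dilation invariance of ω absorbs the
doubling (`tracePos_add`). Cyclicity then follows from unitary invariance. Given the trace, wΦ ↦ w*Φ
is isometric on 𝒞Φ = H_∞, which is dense because the resolvent is compact, and its extension is J.
On the orbit w^op is right multiplication, vΦ ↦ vwΦ. It therefore commutes with 𝒞, hence with 𝒞'',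
which gives J(TΦ) = T*Φ for T in 𝒞''. Everything else is an identity on the orbit. Since εΦ = Φ,
ε(wΦ) = (εwε)Φ, where w ↦ εwε fixes 𝒜 and negates each [D, a]. For p even C induces the same
automorphism, whence ε = CC^op; for p odd C is central in 𝒞, so its left and right multiplications
agree. Finally H_∞ is a copy of 𝒞 with pairings uzv* and u*zv, full because z is invertible in the
closure. -/

noncomputable section

namespace NCG

set_option linter.unusedSectionVars false

/-! ### Singular values as approximation numbers. -/

section SingularValues

variable {H : Type*} [NormedAddCommGroup H] [InnerProductSpace ℂ H] [CompleteSpace H]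

/-- The rank of a bounded operator is at most `n`. -/
def RankLE (F : H →L[ℂ] H) (n : ℕ) : Prop := LinearMap.rank (F : H →ₗ[ℂ] H) ≤ (n : Cardinal)

namespace RankLE

variable {F G : H →L[ℂ] H} {m n : ℕ}

lemma zero (n : ℕ) : RankLE (0 : H →L[ℂ] H) n := by
  simp [RankLE]

lemma mono (h : RankLE F m) (hmn : m ≤ n) : RankLE F n :=
  h.trans (by exact_mod_cast hmn)

lemma add (hF : RankLE F m) (hG : RankLE G n) : RankLE (F + G) (m + n) := by
  have := LinearMap.rank_add_le (F : H →ₗ[ℂ] H) (G : H →ₗ[ℂ] H)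
  unfold RankLE at *
  rw [Nat.cast_add]
  exact this.trans (add_le_add hF hG)

lemma mul_left (A : H →L[ℂ] H) (hF : RankLE F n) : RankLE (A * F) n :=
  (LinearMap.rank_comp_le_right (F : H →ₗ[ℂ] H) (A : H →ₗ[ℂ] H)).trans hF

lemma mul_right (A : H →L[ℂ] H) (hF : RankLE F n) : RankLE (F * A) n :=
  (LinearMap.rank_comp_le_left (A : H →ₗ[ℂ] H) (F : H →ₗ[ℂ] H)).trans hF

lemma finiteDimensional_range (hF : RankLE F n) :
    FiniteDimensional ℂ (LinearMap.range (F : H →ₗ[ℂ] H)) :=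
  Module.rank_lt_aleph0_iff.1 (lt_of_le_of_lt hF (Cardinal.natCast_lt_aleph0))

lemma starProjection_le {K : Submodule ℂ H} [FiniteDimensional ℂ K]
    (h : Module.finrank ℂ K ≤ n) : RankLE (K.starProjection) n := by
  have h1 : LinearMap.range (K.starProjection : H →ₗ[ℂ] H) = K :=
    Submodule.range_starProjection K
  unfold RankLE LinearMap.rank
  rw [h1, ← Module.finrank_eq_rank]
  exact_mod_cast h

/-- With P the finite-rank projection onto the range of F, F = PF, hence F* = F*P. -/
lemma star (hF : RankLE F n) : RankLE (star F) n := by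
  have := hF.finiteDimensional_range
  set K := LinearMap.range (F : H →ₗ[ℂ] H)
  have h1 : K.starProjection * F = F := by
    ext x
    exact Submodule.starProjection_eq_self_iff.2 ⟨x, rfl⟩
  have h2 : Star.star F = Star.star F * K.starProjection := by
    conv_lhs => rw [← h1]
    rw [star_mul, (isSelfAdjoint_starProjection K).star_eq]
  rw [h2]
  refine mul_left _ (starProjection_le ?_)
  have : (Module.finrank ℂ K : Cardinal) ≤ n := by
    rw [Module.finrank_eq_rank]; exact hF
  exact_mod_cast this

/-- An operator of rank at most `n` vanishes on a closed subspace of codimension at most `n`. -/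
lemma exists_projection (hF : RankLE F n) : ∃ P : H →L[ℂ] H, F * P = 0 ∧ ‖P‖ ≤ 1 ∧
    RankLE (1 - P) n := by
  have hcl : IsClosed ((LinearMap.ker (F : H →ₗ[ℂ] H) : Submodule ℂ H) : Set H) :=
    ContinuousLinearMap.isClosed_ker F
  set K : Submodule ℂ H := LinearMap.ker (F : H →ₗ[ℂ] H)
  have : CompleteSpace K := hcl.completeSpace_coe
  refine ⟨K.starProjection, ?_, Submodule.starProjection_norm_le K, ?_⟩
  · ext x
    exact LinearMap.mem_ker.1 (Submodule.starProjection_apply_mem K x)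
  · have h1 : (1 - K.starProjection : H →L[ℂ] H) = Kᗮ.starProjection := by
      rw [Submodule.starProjection_orthogonal]; rfl
    have h2 : LinearMap.range (Kᗮ.starProjection : H →ₗ[ℂ] H) = Kᗮ :=
      Submodule.range_starProjection Kᗮ
    unfold RankLE LinearMap.rank
    rw [h1, h2]
    refine le_trans ?_ hF
    have hinj : Function.Injective
        (((F : H →ₗ[ℂ] H).rangeRestrict).comp Kᗮ.subtype) := by
      rw [← LinearMap.ker_eq_bot, LinearMap.ker_eq_bot']
      intro x hx
      have hxK : (x : H) ∈ K := by
        have := congrArg Subtype.val hx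
        exact this
      have := Submodule.inner_right_of_mem_orthogonal hxK x.2
      exact Subtype.ext (inner_self_eq_zero.1 this)
    exact LinearMap.rank_le_of_injective _ hinj

end RankLE

lemma bddBelow_singularValue (T : H →L[ℂ] H) (n : ℕ) :
    BddBelow {r | ∃ F : H →L[ℂ] H, LinearMap.rank (F : H →ₗ[ℂ] H) ≤ (n : Cardinal) ∧
      r = ‖T - F‖} :=
  ⟨0, by rintro r ⟨F, -, rfl⟩; positivity⟩

lemma singularValue_le (T : H →L[ℂ] H) {F : H →L[ℂ] H} {n : ℕ} (hF : RankLE F n) :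
    singularValue T n ≤ ‖T - F‖ :=
  csInf_le (bddBelow_singularValue T n) ⟨F, hF, rfl⟩

lemma le_singularValue {T : H →L[ℂ] H} {n : ℕ} {c : ℝ}
    (h : ∀ F : H →L[ℂ] H, RankLE F n → c ≤ ‖T - F‖) : c ≤ singularValue T n :=
  le_csInf ⟨_, 0, RankLE.zero n, rfl⟩ (by rintro r ⟨F, hF, rfl⟩; exact h F hF)

lemma singularValue_nonneg (T : H →L[ℂ] H) (n : ℕ) : 0 ≤ singularValue T n :=
  le_singularValue fun _ _ => norm_nonneg _

lemma exists_lt_singularValue_add (T : H →L[ℂ] H) (n : ℕ) {δ : ℝ} (hδ : 0 < δ) :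
    ∃ F : H →L[ℂ] H, RankLE F n ∧ ‖T - F‖ < singularValue T n + δ := by
  obtain ⟨r, ⟨F, hF, rfl⟩, hr⟩ := exists_lt_of_csInf_lt
    (s := {r | ∃ F : H →L[ℂ] H, LinearMap.rank (F : H →ₗ[ℂ] H) ≤ (n : Cardinal) ∧
      r = ‖T - F‖}) ⟨_, 0, RankLE.zero n, rfl⟩ (lt_add_of_pos_right (singularValue T n) hδ)
  exact ⟨F, hF, hr⟩

lemma singularValue_antitone (T : H →L[ℂ] H) : Antitone (singularValue T) := fun _ _ hmn =>
  le_singularValue fun _ hF => singularValue_le T (hF.mono hmn)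

lemma singularValue_add_le (S T : H →L[ℂ] H) (m n : ℕ) :
    singularValue (S + T) (m + n) ≤ singularValue S m + singularValue T n := by
  refine le_of_forall_pos_le_add fun δ hδ => ?_
  obtain ⟨F, hF, hF'⟩ := exists_lt_singularValue_add S m (half_pos hδ)
  obtain ⟨G, hG, hG'⟩ := exists_lt_singularValue_add T n (half_pos hδ)
  have h1 := singularValue_le (S + T) (hF.add hG)
  have h2 : ‖S + T - (F + G)‖ ≤ ‖S - F‖ + ‖T - G‖ := by
    rw [add_sub_add_comm]; exact norm_add_le _ _
  linarith

lemma singularValue_mul_le (S T : H →L[ℂ] H) (m n : ℕ) :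
    singularValue (S * T) (m + n) ≤ singularValue S m * singularValue T n := by
  have key : ∀ δ : ℝ, 0 < δ → singularValue (S * T) (m + n) ≤
      (singularValue S m + δ) * (singularValue T n + δ) := by
    intro δ hδ
    obtain ⟨F, hF, hF'⟩ := exists_lt_singularValue_add S m hδ
    obtain ⟨G, hG, hG'⟩ := exists_lt_singularValue_add T n hδ
    -- The approximant FT + (S − F)G is chosen so that the error factors as (S − F)(T − G).
    have h1 := singularValue_le (S * T) ((hF.mul_right T).add (hG.mul_left (S - F)))
    have h2 : S * T - (F * T + (S - F) * G) = (S - F) * (T - G) := by noncomm_ring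
    rw [h2] at h1
    exact h1.trans ((norm_mul_le _ _).trans
      (mul_le_mul hF'.le hG'.le (norm_nonneg _)
        (add_nonneg (singularValue_nonneg S m) hδ.le)))
  have hc : Filter.Tendsto (fun δ : ℝ => (singularValue S m + δ) * (singularValue T n + δ))
      (nhdsWithin 0 (Set.Ioi 0)) (nhds (singularValue S m * singularValue T n)) := by
    have : Continuous fun δ : ℝ => (singularValue S m + δ) * (singularValue T n + δ) := by
      fun_prop
    have h := this.tendsto 0
    simp only [add_zero] at h
    exact h.mono_left nhdsWithin_le_nhds
  exact ge_of_tendsto hc (Filter.eventually_of_mem self_mem_nhdsWithin key)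

lemma singularValue_le_norm (T : H →L[ℂ] H) (n : ℕ) : singularValue T n ≤ ‖T‖ := by
  simpa using singularValue_le T (RankLE.zero n)

lemma singularValue_mul_left_le (A T : H →L[ℂ] H) (n : ℕ) :
    singularValue (A * T) n ≤ ‖A‖ * singularValue T n := by
  have := singularValue_mul_le A T 0 n
  rw [zero_add] at this
  exact this.trans (mul_le_mul_of_nonneg_right (singularValue_le_norm A 0)
    (singularValue_nonneg T n))

lemma singularValue_mul_right_le (T A : H →L[ℂ] H) (n : ℕ) :
    singularValue (T * A) n ≤ singularValue T n * ‖A‖ :=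
  (singularValue_mul_le T A n 0).trans (mul_le_mul_of_nonneg_left (singularValue_le_norm A 0)
    (singularValue_nonneg T n))

lemma singularValue_smul_le (c : ℂ) (T : H →L[ℂ] H) (n : ℕ) :
    singularValue (c • T) n ≤ ‖c‖ * singularValue T n := by
  have := singularValue_mul_left_le (c • 1) T n
  rw [smul_one_mul] at this
  refine this.trans (mul_le_mul_of_nonneg_right ?_ (singularValue_nonneg T n))
  calc ‖c • (1 : H →L[ℂ] H)‖ ≤ ‖c‖ * ‖(1 : H →L[ℂ] H)‖ := norm_smul_le _ _
    _ ≤ ‖c‖ * 1 := mul_le_mul_of_nonneg_left ContinuousLinearMap.norm_id_le (norm_nonneg c)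
    _ = ‖c‖ := mul_one _

lemma singularValue_smul (c : ℂ) (T : H →L[ℂ] H) (n : ℕ) :
    singularValue (c • T) n = ‖c‖ * singularValue T n := by
  refine le_antisymm (singularValue_smul_le c T n) ?_
  rcases eq_or_ne c 0 with rfl | hc
  · simpa using singularValue_nonneg _ n
  · have := singularValue_smul_le c⁻¹ (c • T) n
    rw [inv_smul_smul₀ hc, norm_inv] at this
    rwa [← le_inv_mul_iff₀ (norm_pos_iff.2 hc)]

lemma singularValue_star_le (T : H →L[ℂ] H) (n : ℕ) :
    singularValue (star T) n ≤ singularValue T n := by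
  refine le_singularValue fun F hF => ?_
  have := singularValue_le (star T) hF.star
  rwa [← star_sub, norm_star] at this

/-- Singular values depend monotonically on the quadratic form `‖T x‖²`. -/
lemma singularValue_mono {S T : H →L[ℂ] H} (h : ∀ x, ‖T x‖ ≤ ‖S x‖) (n : ℕ) :
    singularValue T n ≤ singularValue S n := by
  refine le_singularValue fun F hF => ?_
  obtain ⟨P, hFP, hP, hr⟩ := hF.exists_projection
  refine (singularValue_le T (hr.mul_left T)).trans ?_
  refine ContinuousLinearMap.opNorm_le_bound _ (norm_nonneg _) fun x => ?_
  have e1 : (T - T * (1 - P)) x = T (P x) := by simp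
  have e2 : S (P x) = (S - F) (P x) := by
    have : F (P x) = 0 := congrArg (fun A : H →L[ℂ] H => A x) hFP
    simp [this]
  rw [e1]
  calc ‖T (P x)‖ ≤ ‖S (P x)‖ := h _
    _ = ‖(S - F) (P x)‖ := by rw [e2]
    _ ≤ ‖S - F‖ * ‖P x‖ := ContinuousLinearMap.le_opNorm _ _
    _ ≤ ‖S - F‖ * (1 * ‖x‖) := by
        gcongr
        exact P.le_of_opNorm_le hP x
    _ = ‖S - F‖ * ‖x‖ := by rw [one_mul]

/-- Cauchy–Schwarz applied to ⟨Aᵏ⁺¹x, Aᵏ⁺¹x⟩ = ⟨Aᵏx, Aᵏ⁺²x⟩ makes k ↦ ‖Aᵏx‖ log-convex, so each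
successive ratio is at least the first one, ‖Ax‖ / ‖x‖. This avoids the spectral theorem. -/
lemma norm_apply_pow_le {A : H →L[ℂ] H} (hA : IsSelfAdjoint A) {x : H} (n : ℕ) :
    ‖A x‖ ^ (n + 1) ≤ ‖(A ^ (n + 1)) x‖ * ‖x‖ ^ n := by
  have hlc : ∀ k, ‖(A ^ (k + 1)) x‖ ^ 2 ≤ ‖(A ^ k) x‖ * ‖(A ^ (k + 2)) x‖ := by
    intro k
    have h1 : inner ℂ ((A ^ (k + 1)) x) ((A ^ (k + 1)) x) =
        inner ℂ ((A ^ k) x) ((A ^ (k + 2)) x) := by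
      rw [pow_succ' A k, pow_succ' A (k + 1), pow_succ' A k]
      simp only [mul_apply_eq_comp]
      have := ContinuousLinearMap.adjoint_inner_left A (A ((A ^ k) x)) ((A ^ k) x)
      rwa [← ContinuousLinearMap.star_eq_adjoint, hA.star_eq] at this
    have h2 : ‖(A ^ (k + 1)) x‖ ^ 2 = ‖inner ℂ ((A ^ k) x) ((A ^ (k + 2)) x)‖ := by
      rw [← h1, inner_self_eq_norm_sq_to_K]; simp
    rw [h2]
    exact norm_inner_le_norm _ _
  rcases eq_or_ne (A x) 0 with h0 | h0
  · rw [h0]; simp; positivity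
  have hpos : 0 < ‖A x‖ := norm_pos_iff.2 h0
  have hratio : ∀ k, ‖A x‖ * ‖(A ^ k) x‖ ≤ ‖(A ^ (k + 1)) x‖ * ‖x‖ ∧ 0 < ‖(A ^ k) x‖ := by
    intro k
    induction k with
    | zero =>
      refine ⟨by simp, ?_⟩
      simp only [pow_zero, one_apply_eq_self, norm_pos_iff]
      rintro rfl; simp at h0
    | succ k ih =>
      obtain ⟨h1, h2⟩ := ih
      have h3 : 0 < ‖(A ^ (k + 1)) x‖ := by
        by_contra hc
        have : ‖(A ^ (k + 1)) x‖ = 0 := le_antisymm (not_lt.1 hc) (norm_nonneg _)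
        rw [this, zero_mul] at h1
        exact absurd h1 (not_le.2 (mul_pos hpos h2))
      refine ⟨?_, h3⟩
      have h4 := hlc k
      have h5 : ‖A x‖ * ‖(A ^ (k + 1)) x‖ * (‖(A ^ k) x‖ * ‖(A ^ (k + 1)) x‖) ≤
          ‖(A ^ (k + 2)) x‖ * ‖x‖ * (‖(A ^ k) x‖ * ‖(A ^ (k + 1)) x‖) := by
        calc _ = (‖A x‖ * ‖(A ^ k) x‖) * ‖(A ^ (k + 1)) x‖ ^ 2 := by ring
          _ ≤ (‖(A ^ (k + 1)) x‖ * ‖x‖) * (‖(A ^ k) x‖ * ‖(A ^ (k + 2)) x‖) := by gcongr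
          _ = _ := by ring
      exact le_of_mul_le_mul_right h5 (by positivity)
  induction n with
  | zero => simp
  | succ n ih =>
    calc ‖A x‖ ^ (n + 1 + 1) = ‖A x‖ * ‖A x‖ ^ (n + 1) := by ring
      _ ≤ ‖A x‖ * (‖(A ^ (n + 1)) x‖ * ‖x‖ ^ n) := by gcongr
      _ = (‖A x‖ * ‖(A ^ (n + 1)) x‖) * ‖x‖ ^ n := by ring
      _ ≤ (‖(A ^ (n + 1 + 1)) x‖ * ‖x‖) * ‖x‖ ^ n := by
          gcongr ?_ * _
          exact (hratio (n + 1)).1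
      _ = _ := by ring

/-- If F approximates the power to within c, then on ker F the operator A is bounded by the (n +
1)-st root of c, and ker F has codimension at most k. -/
lemma singularValue_pow_le {A : H →L[ℂ] H} (hA : IsSelfAdjoint A) (n k : ℕ) :
    singularValue A k ^ (n + 1) ≤ singularValue (A ^ (n + 1)) k := by
  refine le_singularValue fun F hF => ?_
  obtain ⟨P, hFP, hP, hr⟩ := hF.exists_projection
  set c := ‖A ^ (n + 1) - F‖
  have hc : 0 ≤ c := norm_nonneg _
  have h1 : singularValue A k ≤ c ^ ((n + 1 : ℕ) : ℝ)⁻¹ := by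
    refine (singularValue_le A (hr.mul_left A)).trans ?_
    refine ContinuousLinearMap.opNorm_le_bound _ (by positivity) fun x => ?_
    have e1 : (A - A * (1 - P)) x = A (P x) := by simp
    rw [e1]
    have e2 : (A ^ (n + 1)) (P x) = (A ^ (n + 1) - F) (P x) := by
      have : F (P x) = 0 := congrArg (fun A : H →L[ℂ] H => A x) hFP
      simp [this]
    have hPx : ‖P x‖ ≤ ‖x‖ := by simpa using P.le_of_opNorm_le hP x
    refine le_of_pow_le_pow_left₀ (Nat.succ_ne_zero n) (by positivity) ?_
    rw [mul_pow, Real.rpow_inv_natCast_pow hc (Nat.succ_ne_zero n)]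
    calc ‖A (P x)‖ ^ (n + 1) ≤ ‖(A ^ (n + 1)) (P x)‖ * ‖P x‖ ^ n := norm_apply_pow_le hA n
      _ ≤ (c * ‖P x‖) * ‖P x‖ ^ n := by
          rw [e2]; gcongr; exact ContinuousLinearMap.le_opNorm _ _
      _ = c * ‖P x‖ ^ (n + 1) := by ring
      _ ≤ c * ‖x‖ ^ (n + 1) := by gcongr
  calc singularValue A k ^ (n + 1) ≤ (c ^ ((n + 1 : ℕ) : ℝ)⁻¹) ^ (n + 1) := by
        gcongr; exact singularValue_nonneg A k
    _ = c := Real.rpow_inv_natCast_pow hc (Nat.succ_ne_zero n)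

lemma singularValue_list_prod_le (l : List (H →L[ℂ] H)) (k : ℕ) :
    singularValue l.prod (l.length * k) ≤ (l.map fun T => singularValue T k).prod := by
  induction l with
  | nil =>
    simpa using (singularValue_le_norm (1 : H →L[ℂ] H) 0).trans ContinuousLinearMap.norm_id_le
  | cons T l ih =>
    simp only [List.prod_cons, List.length_cons, List.map_cons]
    rw [add_mul, one_mul, add_comm]
    exact (singularValue_mul_le _ _ _ _).trans
      (mul_le_mul_of_nonneg_left ih (singularValue_nonneg T k))

end SingularValues

/-! ### Ky Fan's maximum principle and sums of singular values. -/

section KyFan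

variable {H : Type*} [NormedAddCommGroup H] [InnerProductSpace ℂ H] [CompleteSpace H]

/-- The sum of the first `n` singular values. -/
def singularSum (T : H →L[ℂ] H) (n : ℕ) : ℝ := ∑ k ∈ Finset.range n, singularValue T k

lemma singularSum_succ (T : H →L[ℂ] H) (n : ℕ) :
    singularSum T (n + 1) = singularSum T n + singularValue T n :=
  Finset.sum_range_succ _ _

lemma singularSum_nonneg (T : H →L[ℂ] H) (n : ℕ) : 0 ≤ singularSum T n :=
  Finset.sum_nonneg fun k _ => singularValue_nonneg T k

lemma singularSum_mono (T : H →L[ℂ] H) : Monotone (singularSum T) :=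
  monotone_nat_of_le_succ fun n => by
    rw [singularSum_succ]; linarith [singularValue_nonneg T n]

lemma inner_apply_apply_of_isSelfAdjoint {S : H →L[ℂ] H} (hS : IsSelfAdjoint S) (x y : H) :
    inner ℂ x (S y) = inner ℂ (S x) y := by
  have := ContinuousLinearMap.adjoint_inner_left S y x
  rw [← ContinuousLinearMap.star_eq_adjoint, hS.star_eq] at this
  exact this.symm

lemma inner_self_eq_ofReal (x : H) : inner ℂ x x = ((‖x‖ ^ 2 : ℝ) : ℂ) := by
  rw [inner_self_eq_norm_sq_to_K]
  norm_cast

lemma norm_sq_apply_le_of_rankLE {S : H →L[ℂ] H} (hS : IsSelfAdjoint S) {F : H →L[ℂ] H} {x : H}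
    (hx : F x = 0) : ‖S x‖ ^ 2 ≤ ‖S * S - F‖ * ‖x‖ ^ 2 := by
  have h1 : ((‖S x‖ ^ 2 : ℝ) : ℂ) = inner ℂ x ((S * S - F) x) := by
    have : (S * S - F) x = S (S x) := by simp [hx]
    rw [this, inner_apply_apply_of_isSelfAdjoint hS, inner_self_eq_norm_sq_to_K]
    norm_cast
  have h2 : ‖S x‖ ^ 2 = ‖inner ℂ x ((S * S - F) x)‖ := by
    rw [← h1, Complex.norm_real, Real.norm_of_nonneg (by positivity)]
  rw [h2]
  calc _ ≤ ‖x‖ * ‖(S * S - F) x‖ := norm_inner_le_norm _ _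
    _ ≤ ‖x‖ * (‖S * S - F‖ * ‖x‖) := by gcongr; exact ContinuousLinearMap.le_opNorm _ _
    _ = _ := by ring

/-- Every finite-dimensional subspace has an orthonormal basis diagonalizing the compression of
`S ^ 2`, and the trace of that compression is at most a sum of singular values. -/
lemma exists_basis_sum_le_singularSum {S : H →L[ℂ] H} (hS : IsSelfAdjoint S) (V : Submodule ℂ H)
    [FiniteDimensional ℂ V] : ∃ g : OrthonormalBasis (Fin (Module.finrank ℂ V)) ℂ V,
      ∑ j, ‖S (g j : H)‖ ^ 2 ≤ singularSum (S * S) (Module.finrank ℂ V) := by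
  set M : V →ₗ[ℂ] V :=
    ((V.orthogonalProjectionOnto ∘L (S * S) ∘L V.subtypeL : V →L[ℂ] V) : V →ₗ[ℂ] V)
  have hM : ∀ v w : V, inner ℂ v (M w) = inner ℂ (S (v : H)) (S (w : H)) := by
    intro v w
    have : inner ℂ v (M w) = inner ℂ (v : H) (S (S (w : H))) := by
      change inner ℂ v (V.orthogonalProjectionOnto (S (S (w : H)))) = _
      exact Submodule.inner_orthogonalProjectionOnto_eq_of_mem_left v _
    rw [this, inner_apply_apply_of_isSelfAdjoint hS]
  have hsymm : M.IsSymmetric := by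
    intro v w
    rw [hM, ← inner_conj_symm, hM, inner_conj_symm]
  set g := hsymm.eigenvectorBasis rfl with hg
  set lam := hsymm.eigenvalues rfl with hlam
  have hMg : ∀ i, M (g i) = (lam i : ℂ) • g i := hsymm.apply_eigenvectorBasis rfl
  have horth : ∀ i j, inner ℂ (S (g i : H)) (S (g j : H)) = if i = j then (lam j : ℂ) else 0 := by
    intro i j
    rw [← hM, hMg, inner_smul_right, orthonormal_iff_ite.1 g.orthonormal]
    split_ifs <;> simp
  have hnorm : ∀ j, ‖S (g j : H)‖ ^ 2 = lam j := by
    intro j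
    have := horth j j
    rw [if_pos rfl, inner_self_eq_ofReal] at this
    exact_mod_cast this
  refine ⟨g, ?_⟩
  unfold singularSum
  rw [← Fin.sum_univ_eq_sum_range (fun k => singularValue (S * S) k)]
  refine Finset.sum_le_sum fun k _ => ?_
  rw [hnorm]
  refine le_singularValue fun F hF => ?_
  have hfd := hF.finiteDimensional_range
  have hFr : Module.finrank ℂ (LinearMap.range (F : H →ₗ[ℂ] H)) ≤ (k : ℕ) := by
    have : (Module.finrank ℂ (LinearMap.range (F : H →ₗ[ℂ] H)) : Cardinal) ≤ (k : ℕ) := by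
      rw [Module.finrank_eq_rank]; exact hF
    exact_mod_cast this
  -- Courant–Fischer: there are k + 1 eigenvectors up to index k and F has rank at most k, so F
  -- kills a nonzero combination of them. On it the Rayleigh quotient of S² is at least `lam k` and
  -- at most ‖S² − F‖.
  let φ : ({i // i ∈ Finset.Iic k} → ℂ) →ₗ[ℂ] H :=
    Fintype.linearCombination ℂ (fun i : {i // i ∈ Finset.Iic k} => ((g i : V) : H))
  have hφ : ∀ c, φ c = ∑ i, c i • ((g i : V) : H) := fun c => by
    simp [φ, Fintype.linearCombination_apply]
  have hnotinj : ¬ Function.Injective (((F : H →ₗ[ℂ] H).rangeRestrict).comp φ) := by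
    intro hinj
    have h1 := LinearMap.finrank_le_finrank_of_injective hinj
    rw [Module.finrank_fintype_fun_eq_card, Fintype.card_coe, Fin.card_Iic] at h1
    omega
  rw [← LinearMap.ker_eq_bot, LinearMap.ker_eq_bot'] at hnotinj
  push Not at hnotinj
  obtain ⟨c, hc, hc0⟩ := hnotinj
  have hFx : F (φ c) = 0 := congrArg Subtype.val hc
  have key := norm_sq_apply_le_of_rankLE hS hFx
  have hx : ‖φ c‖ ^ 2 = ∑ i, ‖c i‖ ^ 2 := by
    have h1 : inner ℂ (φ c) (φ c) = ∑ i, (starRingEnd ℂ) (c i) * c i := by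
      rw [hφ]
      have ho : Orthonormal ℂ (fun i : {i // i ∈ Finset.Iic k} => ((g i : V) : H)) := by
        have := g.orthonormal.comp_linearIsometry V.subtypeₗᵢ
        exact this.comp _ Subtype.val_injective
      exact ho.inner_sum c c Finset.univ
    rw [inner_self_eq_ofReal] at h1
    simp_rw [← Complex.normSq_eq_conj_mul_self, Complex.normSq_eq_norm_sq] at h1
    exact_mod_cast h1
  have hSx : ‖S (φ c)‖ ^ 2 = ∑ i : {i // i ∈ Finset.Iic k}, lam i.1 * ‖c i‖ ^ 2 := by
    have h1 : inner ℂ (S (φ c)) (S (φ c)) = ∑ i : {i // i ∈ Finset.Iic k}, (lam i.1 : ℂ) * ((starRingEnd ℂ) (c i) * c i) := by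
      rw [hφ]
      simp only [map_sum, map_smul, sum_inner, inner_sum, inner_smul_left, inner_smul_right, horth]
      refine Finset.sum_congr rfl fun i _ => ?_
      rw [Finset.sum_eq_single i]
      · rw [if_pos rfl]; ring
      · intro j _ hj
        rw [if_neg (fun h => hj (Subtype.ext h))]; simp
      · simp
    rw [inner_self_eq_ofReal] at h1
    simp_rw [← Complex.normSq_eq_conj_mul_self, Complex.normSq_eq_norm_sq] at h1
    exact_mod_cast h1
  have hlow : lam k * ‖φ c‖ ^ 2 ≤ ‖S (φ c)‖ ^ 2 := by
    rw [hx, hSx, Finset.mul_sum]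
    refine Finset.sum_le_sum fun i _ => ?_
    gcongr
    exact hsymm.eigenvalues_antitone rfl (Finset.mem_Iic.1 i.2)
  have hpos : 0 < ‖φ c‖ ^ 2 := by
    rw [hx]
    obtain ⟨i, hi⟩ := Function.ne_iff.1 hc0
    exact Finset.sum_pos' (fun _ _ => by positivity)
      ⟨i, Finset.mem_univ i, by have := norm_pos_iff.2 hi; positivity⟩
  exact le_of_mul_le_mul_right (hlow.trans key) hpos

/-- The trace of a compression dominates the diagonal sum over any orthonormal set in the
subspace. -/
lemma sum_norm_sq_le_sum_basis {S : H →L[ℂ] H} (hS : IsSelfAdjoint S) (V : Submodule ℂ H)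
    [FiniteDimensional ℂ V] {ι : Type*} [Fintype ι] (g : OrthonormalBasis ι ℂ V) {s : Finset H}
    (hs : Orthonormal ℂ ((↑) : s → H)) (hsV : ∀ x ∈ s, x ∈ V) :
    ∑ x ∈ s, ‖S x‖ ^ 2 ≤ ∑ j, ‖S (g j : H)‖ ^ 2 := by
  -- Expanding Sx in an orthonormal basis h of S(V) turns both sides into double sums of squared
  -- inner products with the projections of S h_l to V: Bessel bounds the sum over s, Parseval
  -- evaluates the sum over g.
  set W : Submodule ℂ H := V.map (S : H →ₗ[ℂ] H)
  set h := stdOrthonormalBasis ℂ W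
  have hW : ∀ x ∈ V, ‖S x‖ ^ 2 = ∑ l, ‖inner ℂ (S (h l : H)) x‖ ^ 2 := by
    intro x hx
    have hm : S x ∈ W := ⟨x, hx, rfl⟩
    have h1 := h.sum_sq_norm_inner_right ⟨S x, hm⟩
    have h2 : ‖(⟨S x, hm⟩ : W)‖ = ‖S x‖ := rfl
    rw [← h2, ← h1]
    refine Finset.sum_congr rfl fun l _ => ?_
    rw [← inner_apply_apply_of_isSelfAdjoint hS]
    rfl
  have hV : ∀ l, ∀ x ∈ V, inner ℂ (S (h l : H)) x =
      inner ℂ (V.starProjection (S (h l : H))) x := by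
    intro l x hx
    rw [Submodule.inner_starProjection_left_eq_right, Submodule.starProjection_eq_self_iff.2 hx]
  calc ∑ x ∈ s, ‖S x‖ ^ 2
      = ∑ x : s, ∑ l, ‖inner ℂ (V.starProjection (S (h l : H))) (x : H)‖ ^ 2 := by
        rw [← Finset.sum_coe_sort]
        refine Finset.sum_congr rfl fun x _ => ?_
        rw [hW x (hsV x x.2)]
        exact Finset.sum_congr rfl fun l _ => by rw [hV l x (hsV x x.2)]
    _ = ∑ l, ∑ x : s, ‖inner ℂ (x : H) (V.starProjection (S (h l : H)))‖ ^ 2 := by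
        rw [Finset.sum_comm]
        simp_rw [norm_inner_symm]
    _ ≤ ∑ l, ‖V.starProjection (S (h l : H))‖ ^ 2 :=
        Finset.sum_le_sum fun l _ => hs.sum_inner_products_le _
    _ = ∑ l, ∑ j, ‖inner ℂ (S (h l : H)) (g j : H)‖ ^ 2 := by
        refine Finset.sum_congr rfl fun l _ => ?_
        have h1 := g.sum_sq_norm_inner_left (V.orthogonalProjectionOnto (S (h l : H)))
        have h2 : ‖V.starProjection (S (h l : H))‖ = ‖V.orthogonalProjectionOnto (S (h l : H))‖ := rfl
        rw [h2, ← h1]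
        refine Finset.sum_congr rfl fun j _ => ?_
        rw [hV l _ (g j).2]
        rfl
    _ = ∑ j, ‖S (g j : H)‖ ^ 2 := by
        rw [Finset.sum_comm]
        exact Finset.sum_congr rfl fun j _ => (hW _ (g j).2).symm

/-- Almost maximizing orthonormal sets in Ky Fan's variational principle. -/
lemma exists_orthonormal_singularSum_le {S : H →L[ℂ] H} (hS : IsSelfAdjoint S) {δ : ℝ}
    (hδ : 0 < δ) (n : ℕ) : ∃ s : Finset H, Orthonormal ℂ ((↑) : s → H) ∧ s.card ≤ n ∧
      singularSum (S * S) n ≤ ∑ x ∈ s, ‖S x‖ ^ 2 + n * δ := by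
  classical
  induction n with
  | zero =>
    refine ⟨∅, ?_, by simp, by simp [singularSum]⟩
    exact ⟨fun i => absurd i.2 (Finset.notMem_empty _),
      fun i => absurd i.2 (Finset.notMem_empty _)⟩
  | succ n ih =>
    obtain ⟨s, hs, hcard, hsum⟩ := ih
    set V : Submodule ℂ H := Submodule.span ℂ (s : Set H) with hVdef
    have hfd : FiniteDimensional ℂ V := FiniteDimensional.span_finset ℂ s
    set P := V.starProjection with hP
    have hPadj : IsSelfAdjoint P := isSelfAdjoint_starProjection V
    have hPP : P * P = P := V.isIdempotentElem_starProjection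
    set q := ‖S * (1 - P)‖ with hq
    -- SPS has rank at most n, and S² − SPS is S(1 − P) times its adjoint, of norm q².
    have hμ : singularValue (S * S) n ≤ q ^ 2 := by
      have hr : RankLE (S * (P * S)) n :=
        ((RankLE.starProjection_le ((finrank_span_finset_le_card s).trans hcard)).mul_right
          S).mul_left S
      refine (singularValue_le _ hr).trans ?_
      have h1 : S * S - S * (P * S) = (S * (1 - P)) * star (S * (1 - P)) := by
        rw [star_mul, star_sub, star_one, hPadj.star_eq, hS.star_eq]
        have : (1 - P) * (1 - P) = 1 - P := by
          rw [mul_sub, sub_mul, sub_mul, hPP]; simp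
        calc S * S - S * (P * S) = S * (1 - P) * S := by noncomm_ring
          _ = S * ((1 - P) * (1 - P)) * S := by rw [this]
          _ = _ := by noncomm_ring
      rw [h1, CStarRing.norm_self_mul_star, sq]
    -- If q² ≤ δ the next singular value is absorbed in the error and s is kept; otherwise s is
    -- enlarged by a unit vector orthogonal to V that nearly attains q.
    rcases le_or_gt (q ^ 2) δ with hqδ | hqδ
    · refine ⟨s, hs, hcard.trans (Nat.le_succ n), ?_⟩
      rw [singularSum_succ]
      push_cast
      linarith
    · have hrlt : Real.sqrt (q ^ 2 - δ) < ‖S * (1 - P)‖ := by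
        rw [← hq, Real.sqrt_lt' (lt_of_le_of_ne (norm_nonneg _) ?_)]
        · linarith
        · intro h0
          rw [hq, ← h0] at hqδ
          norm_num at hqδ
          linarith
      obtain ⟨y, hy1, hy2⟩ := ContinuousLinearMap.exists_lt_apply_of_lt_opNorm _ hrlt
      set e' := (1 - P) y with he'
      have hSe' : (S * (1 - P)) y = S e' := rfl
      rw [hSe'] at hy2
      have he0 : e' ≠ 0 := by
        intro h0
        rw [h0] at hy2
        simp at hy2
        exact absurd hy2 (not_lt.2 (Real.sqrt_nonneg _))
      have hen : 0 < ‖e'‖ := norm_pos_iff.2 he0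
      have he1 : ‖e'‖ ≤ 1 := by
        have h1 : e' = Vᗮ.starProjection y := by
          rw [Submodule.starProjection_orthogonal]; rfl
        rw [h1]
        exact (Vᗮ.norm_starProjection_apply_le y).trans hy1.le
      have heV : ∀ x ∈ V, inner ℂ x e' = 0 := by
        intro x hx
        have h1 : e' = Vᗮ.starProjection y := by
          rw [Submodule.starProjection_orthogonal]; rfl
        rw [h1]
        exact Submodule.inner_right_of_mem_orthogonal hx (Submodule.starProjection_apply_mem _ _)
      set e : H := ((‖e'‖⁻¹ : ℝ) : ℂ) • e' with he
      have hee : ‖e‖ = 1 := by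
        rw [he, norm_smul, Complex.norm_real, Real.norm_of_nonneg (by positivity),
          inv_mul_cancel₀ hen.ne']
      have heV' : ∀ x ∈ V, inner ℂ x e = 0 := fun x hx => by
        rw [he, inner_smul_right, heV x hx, mul_zero]
      have hes : e ∉ s := by
        intro h
        have := heV' e (Submodule.subset_span h)
        rw [inner_self_eq_zero] at this
        rw [this] at hee
        simp at hee
      have hSe : q ^ 2 - δ ≤ ‖S e‖ ^ 2 := by
        -- Normalizing can only increase the value, because ‖e'‖ ≤ 1.
        have h1 : ‖S e'‖ ≤ ‖S e‖ := by
          rw [he, map_smul, norm_smul, Complex.norm_real, Real.norm_of_nonneg (by positivity)]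
          have : 1 ≤ ‖e'‖⁻¹ := (one_le_inv₀ hen).2 he1
          nlinarith [norm_nonneg (S e')]
        have h2 := hy2.le.trans h1
        exact (Real.sqrt_le_left (norm_nonneg _)).1 h2
      refine ⟨insert e s, ?_, ?_, ?_⟩
      · have h1 : Orthonormal ℂ ((↑) : ((insert e s : Finset H) : Set H) → H) := by
          have hs' := (orthonormal_subtype_iff_ite (s := (s : Set H))).1 hs
          rw [orthonormal_subtype_iff_ite]
          intro v hv w hw
          rw [Finset.mem_coe, Finset.mem_insert] at hv hw
          rcases hv with rfl | hv <;> rcases hw with rfl | hw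
          · rw [if_pos rfl, inner_self_eq_norm_sq_to_K, hee]; simp
          · rw [if_neg (by rintro h; exact hes (h ▸ hw)), ← inner_conj_symm,
              heV' w (Submodule.subset_span hw), map_zero]
          · rw [if_neg (by rintro h; exact hes (h ▸ hv)), heV' v (Submodule.subset_span hv)]
          · exact hs' v hv w hw
        exact h1
      · rw [Finset.card_insert_of_notMem hes]; omega
      · rw [Finset.sum_insert hes, singularSum_succ]
        push_cast
        linarith

lemma sqrt_props {T : H →L[ℂ] H} (hT : 0 ≤ T) :
    IsSelfAdjoint (CFC.sqrt T) ∧ CFC.sqrt T * CFC.sqrt T = T :=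
  ⟨.of_nonneg (CFC.sqrt_nonneg T), CFC.sqrt_mul_sqrt_self T⟩

/-- ‖√A x‖² is the quadratic form ⟨x, Ax⟩, which is additive in A. Diagonal sums of S, T and S + T
can thus be compared on one orthonormal set. -/
lemma norm_sq_sqrt_add {S T : H →L[ℂ] H} (hS : 0 ≤ S) (hT : 0 ≤ T) (x : H) :
    ‖CFC.sqrt (S + T) x‖ ^ 2 = ‖CFC.sqrt S x‖ ^ 2 + ‖CFC.sqrt T x‖ ^ 2 := by
  have key : ∀ A : H →L[ℂ] H, 0 ≤ A → ((‖CFC.sqrt A x‖ ^ 2 : ℝ) : ℂ) = inner ℂ x (A x) := by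
    intro A hA
    obtain ⟨h1, h2⟩ := sqrt_props hA
    have h3 : A x = CFC.sqrt A (CFC.sqrt A x) := by
      conv_lhs => rw [← h2]
      rfl
    rw [h3, inner_apply_apply_of_isSelfAdjoint h1, inner_self_eq_norm_sq_to_K]
    norm_cast
  have h := key (S + T) (add_nonneg hS hT)
  rw [add_apply, inner_add_right, ← key S hS, ← key T hT] at h
  exact_mod_cast h

/-- The upper half of Ky Fan's principle, obtained by compressing to the span of s;
`exists_orthonormal_singularSum_le` is the other half. -/
lemma sum_norm_sq_le_singularSum {S : H →L[ℂ] H} (hS : IsSelfAdjoint S) {s : Finset H}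
    (hs : Orthonormal ℂ ((↑) : s → H)) {n : ℕ} (hn : s.card ≤ n) :
    ∑ x ∈ s, ‖S x‖ ^ 2 ≤ singularSum (S * S) n := by
  have := FiniteDimensional.span_finset ℂ s
  obtain ⟨g, hg⟩ := exists_basis_sum_le_singularSum hS (Submodule.span ℂ (s : Set H))
  refine (sum_norm_sq_le_sum_basis hS _ g hs fun x hx => Submodule.subset_span hx).trans
    (hg.trans (singularSum_mono _ ((finrank_span_finset_le_card s).trans hn)))

/-- A nearly maximizing set for S + T is a competitor for S and for T. -/
lemma singularSum_add_le {S T : H →L[ℂ] H} (hS : 0 ≤ S) (hT : 0 ≤ T) (n : ℕ) :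
    singularSum (S + T) n ≤ singularSum S n + singularSum T n := by
  refine le_of_forall_pos_le_add fun δ hδ => ?_
  obtain ⟨h1, h2⟩ := sqrt_props (add_nonneg hS hT)
  obtain ⟨s, hs, hcard, hsum⟩ := exists_orthonormal_singularSum_le h1
    (show 0 < δ / (n + 1) by positivity) n
  rw [h2] at hsum
  simp_rw [norm_sq_sqrt_add hS hT, Finset.sum_add_distrib] at hsum
  have hS' := sum_norm_sq_le_singularSum (sqrt_props hS).1 hs hcard
  have hT' := sum_norm_sq_le_singularSum (sqrt_props hT).1 hs hcard
  rw [(sqrt_props hS).2] at hS'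
  rw [(sqrt_props hT).2] at hT'
  have : (n : ℝ) * (δ / (n + 1)) ≤ δ := by
    rw [mul_div_assoc', div_le_iff₀ (by positivity)]
    nlinarith
  linarith

/-- Nearly maximizing sets for S and for T together span at most 2n dimensions, and the trace of S +
T compressed to that span dominates both diagonal sums. -/
lemma le_singularSum_add {S T : H →L[ℂ] H} (hS : 0 ≤ S) (hT : 0 ≤ T) (n : ℕ) :
    singularSum S n + singularSum T n ≤ singularSum (S + T) (2 * n) := by
  classical
  refine le_of_forall_pos_le_add fun δ hδ => ?_
  obtain ⟨hS1, hS2⟩ := sqrt_props hS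
  obtain ⟨hT1, hT2⟩ := sqrt_props hT
  obtain ⟨h1, h2⟩ := sqrt_props (add_nonneg hS hT)
  have hδ' : 0 < δ / (2 * (n + 1)) := by positivity
  obtain ⟨s, hs, hcs, hss⟩ := exists_orthonormal_singularSum_le hS1 hδ' n
  obtain ⟨t, ht, hct, hts⟩ := exists_orthonormal_singularSum_le hT1 hδ' n
  rw [hS2] at hss
  rw [hT2] at hts
  have hfd := FiniteDimensional.span_finset ℂ (s ∪ t)
  obtain ⟨g, hg⟩ := exists_basis_sum_le_singularSum h1 (Submodule.span ℂ ((s ∪ t : Finset H) : Set H))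
  rw [h2] at hg
  simp_rw [norm_sq_sqrt_add hS hT, Finset.sum_add_distrib] at hg
  have e1 := sum_norm_sq_le_sum_basis hS1 _ g hs fun x hx =>
    Submodule.subset_span (Finset.mem_coe.2 (Finset.mem_union_left t hx))
  have e2 := sum_norm_sq_le_sum_basis hT1 _ g ht fun x hx =>
    Submodule.subset_span (Finset.mem_coe.2 (Finset.mem_union_right s hx))
  have hcard : Module.finrank ℂ (Submodule.span ℂ ((s ∪ t : Finset H) : Set H)) ≤ 2 * n :=
    (finrank_span_finset_le_card _).trans ((Finset.card_union_le s t).trans (by omega))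
  have hm := singularSum_mono (S + T) hcard
  have : (n : ℝ) * (δ / (2 * (n + 1))) ≤ δ / 2 := by
    rw [mul_div_assoc', div_le_iff₀ (by positivity)]
    nlinarith
  linarith

end KyFan

/-! ### Logarithmic means and the Dixmier trace. -/

section DixmierTrace

variable {H : Type*} [NormedAddCommGroup H] [InnerProductSpace ℂ H] [CompleteSpace H]

lemma log_add_two_pos (n : ℕ) : 0 < Real.log ((n : ℝ) + 2) :=
  Real.log_pos (by have : (0 : ℝ) ≤ n := n.cast_nonneg; linarith)

lemma tendsto_log_add_two : Filter.Tendsto (fun n : ℕ => Real.log ((n : ℝ) + 2))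
    Filter.atTop Filter.atTop :=
  Real.tendsto_log_atTop.comp
    (Filter.tendsto_atTop_add_const_right _ _ tendsto_natCast_atTop_atTop)

lemma logMean_eq (T : H →L[ℂ] H) (n : ℕ) :
    logMean T n = singularSum T (n + 1) / Real.log (n + 2) := rfl

lemma logMean_nonneg (T : H →L[ℂ] H) (n : ℕ) : 0 ≤ logMean T n :=
  div_nonneg (singularSum_nonneg T _) (log_add_two_pos n).le

/-- The logarithmic means are bounded. -/
def LogBounded (T : H →L[ℂ] H) : Prop := ∃ K : ℝ, ∀ n, logMean T n ≤ K

/-- The logarithmic means tend to zero. -/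
def LogNegligible (T : H →L[ℂ] H) : Prop :=
  Filter.Tendsto (logMean T) Filter.atTop (nhds 0)

lemma logMean_le_mul {S T : H →L[ℂ] H} {c : ℝ}
    (h : ∀ n, singularValue T n ≤ c * singularValue S n) (n : ℕ) :
    logMean T n ≤ c * logMean S n := by
  rw [logMean_eq, logMean_eq, ← mul_div_assoc]
  refine div_le_div_of_nonneg_right ?_ (log_add_two_pos n).le
  unfold singularSum
  rw [Finset.mul_sum]
  exact Finset.sum_le_sum fun k _ => h k

/-- Cut the sum into m blocks of length r and bound each block by its first term. -/
lemma singularSum_mul_le (T : H →L[ℂ] H) (r m : ℕ) :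
    singularSum T (r * m) ≤ r * ∑ k ∈ Finset.range m, singularValue T (r * k) := by
  induction m with
  | zero => simp [singularSum]
  | succ m ih =>
    have h1 : singularSum T (r * (m + 1)) =
        singularSum T (r * m) + ∑ j ∈ Finset.range r, singularValue T (r * m + j) := by
      rw [mul_add, mul_one]
      exact Finset.sum_range_add _ _ _
    have h2 : ∑ j ∈ Finset.range r, singularValue T (r * m + j) ≤ r * singularValue T (r * m) := by
      calc _ ≤ ∑ j ∈ Finset.range r, singularValue T (r * m) :=
            Finset.sum_le_sum fun j _ => singularValue_antitone T (Nat.le_add_right _ _)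
        _ = _ := by simp
    rw [h1, Finset.sum_range_succ, mul_add]
    linarith

/-- A crude bound valid without positivity, from the inequality at index 2k = k + k. The factor 2 is
harmless for boundedness and for convergence to zero. -/
lemma logMean_add_le (S T : H →L[ℂ] H) (n : ℕ) :
    logMean (S + T) n ≤ 2 * (logMean S n + logMean T n) := by
  rw [logMean_eq, logMean_eq, logMean_eq, ← add_div, ← mul_div_assoc]
  refine div_le_div_of_nonneg_right ?_ (log_add_two_pos n).le
  calc singularSum (S + T) (n + 1) ≤ singularSum (S + T) (2 * (n + 1)) :=
        singularSum_mono _ (by omega)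
    _ ≤ (2 : ℕ) * ∑ k ∈ Finset.range (n + 1), singularValue (S + T) (2 * k) :=
        singularSum_mul_le _ _ _
    _ ≤ 2 * ∑ k ∈ Finset.range (n + 1), (singularValue S k + singularValue T k) := by
        push_cast
        gcongr with k
        rw [two_mul k]
        exact singularValue_add_le S T k k
    _ = _ := by rw [Finset.sum_add_distrib]; rfl

namespace LogBounded

variable {S T : H →L[ℂ] H}

lemma of_le {c : ℝ} (hc : 0 ≤ c) (hS : LogBounded S)
    (h : ∀ n, singularValue T n ≤ c * singularValue S n) : LogBounded T := by
  obtain ⟨K, hK⟩ := hS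
  exact ⟨c * K, fun n => (logMean_le_mul h n).trans (mul_le_mul_of_nonneg_left (hK n) hc)⟩

lemma mul_left (A : H →L[ℂ] H) (hT : LogBounded T) : LogBounded (A * T) :=
  hT.of_le (norm_nonneg A) (singularValue_mul_left_le A T)

lemma mul_right (hT : LogBounded T) (A : H →L[ℂ] H) : LogBounded (T * A) :=
  hT.of_le (norm_nonneg A) fun n => by
    rw [mul_comm]; exact singularValue_mul_right_le T A n

lemma smul (c : ℂ) (hT : LogBounded T) : LogBounded (c • T) :=
  hT.of_le (norm_nonneg c) (singularValue_smul_le c T)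

lemma star (hT : LogBounded T) : LogBounded (star T) :=
  hT.of_le zero_le_one fun n => by rw [one_mul]; exact singularValue_star_le T n

lemma add (hS : LogBounded S) (hT : LogBounded T) : LogBounded (S + T) := by
  obtain ⟨K, hK⟩ := hS
  obtain ⟨L, hL⟩ := hT
  refine ⟨2 * (K + L), fun n => (logMean_add_le S T n).trans ?_⟩
  gcongr
  · exact hK n
  · exact hL n

lemma neg (hT : LogBounded T) : LogBounded (-T) := by
  simpa using hT.smul (-1)

lemma sub (hS : LogBounded S) (hT : LogBounded T) : LogBounded (S - T) := by
  rw [sub_eq_add_neg]; exact hS.add hT.neg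

end LogBounded

namespace LogNegligible

variable {S T : H →L[ℂ] H}

lemma of_le {c : ℝ} (hS : LogNegligible S)
    (h : ∀ n, singularValue T n ≤ c * singularValue S n) : LogNegligible T :=
  squeeze_zero (logMean_nonneg T) (logMean_le_mul h) (by simpa using hS.const_mul c)

lemma mul_left (A : H →L[ℂ] H) (hT : LogNegligible T) : LogNegligible (A * T) :=
  hT.of_le (singularValue_mul_left_le A T)

lemma mul_right (hT : LogNegligible T) (A : H →L[ℂ] H) : LogNegligible (T * A) :=
  hT.of_le (c := ‖A‖) fun n => by
    rw [mul_comm]; exact singularValue_mul_right_le T A n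

lemma smul (c : ℂ) (hT : LogNegligible T) : LogNegligible (c • T) :=
  hT.of_le (singularValue_smul_le c T)

lemma star (hT : LogNegligible T) : LogNegligible (star T) :=
  hT.of_le (c := 1) fun n => by rw [one_mul]; exact singularValue_star_le T n

lemma add (hS : LogNegligible S) (hT : LogNegligible T) : LogNegligible (S + T) :=
  squeeze_zero (logMean_nonneg _) (logMean_add_le S T)
    (by
      have := (Filter.Tendsto.add hS hT).const_mul 2
      simpa using this)

lemma neg (hT : LogNegligible T) : LogNegligible (-T) := by
  simpa using hT.smul (-1)

lemma zero : LogNegligible (0 : H →L[ℂ] H) := by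
  have h : ∀ n, singularValue (0 : H →L[ℂ] H) n = 0 := fun n =>
    le_antisymm (by simpa using singularValue_le_norm (0 : H →L[ℂ] H) n) (singularValue_nonneg _ _)
  have : logMean (0 : H →L[ℂ] H) = fun _ => 0 := by
    ext n; simp [logMean, h]
  unfold LogNegligible
  rw [this]
  exact tendsto_const_nhds

lemma sum {ι : Type*} (s : Finset ι) {f : ι → H →L[ℂ] H} (h : ∀ i ∈ s, LogNegligible (f i)) :
    LogNegligible (∑ i ∈ s, f i) := by
  classical
  induction s using Finset.induction_on with
  | empty => simpa using zero
  | insert a s ha ih =>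
    rw [Finset.sum_insert ha]
    exact (h a (Finset.mem_insert_self a s)).add
      (ih fun i hi => h i (Finset.mem_insert_of_mem hi))

lemma logBounded (hT : LogNegligible T) : LogBounded T := by
  obtain ⟨K, hK⟩ := Filter.Tendsto.bddAbove_range hT
  exact ⟨K, fun n => hK ⟨n, rfl⟩⟩

end LogNegligible

/-! ### Additivity of the Dixmier trace on positive operators. -/

namespace DixmierLimit

variable (ω : DixmierLimit)

lemma toFun_mono {x y : BoundedContinuousFunction ℕ ℝ} (h : ∀ n, x n ≤ y n) :
    ω.toFun x ≤ ω.toFun y := by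
  have := ω.nonneg (y - x) fun n => by
    rw [BoundedContinuousFunction.sub_apply]; linarith [h n]
  rw [map_sub] at this
  linarith

/-- The bounded sequence of logarithmic means. -/
lemma exists_bounded {T : H →L[ℂ] H} (hT : LogBounded T) :
    ∃ x : BoundedContinuousFunction ℕ ℝ, ∀ n, x n = logMean T n := by
  obtain ⟨K, hK⟩ := hT
  exact ⟨BoundedContinuousFunction.ofNormedAddCommGroupDiscrete (logMean T) K fun n => by
    rw [Real.norm_of_nonneg (logMean_nonneg T n)]; exact hK n, fun n => rfl⟩

/-- The bound inside the definition of `tracePos` is a choice; this shows that the value depends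
only on the sequence. -/
lemma tracePos_eq {T : H →L[ℂ] H} {x : BoundedContinuousFunction ℕ ℝ}
    (hx : ∀ n, x n = logMean T n) : ω.tracePos T = ω.toFun x := by
  have h : ∃ K : ℝ, ∀ n, ‖logMean T n‖ ≤ K := ⟨‖x‖, fun n => by
    rw [← hx]; exact x.norm_coe_le_norm n⟩
  unfold tracePos
  rw [dif_pos h]
  congr 1
  ext n
  exact (hx n).symm

lemma tracePos_congr {S T : H →L[ℂ] H} (h : ∀ n, singularValue S n = singularValue T n) :
    ω.tracePos S = ω.tracePos T := by
  have h1 : ∀ n, logMean S n = logMean T n := fun n => by simp [logMean, h]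
  by_cases hT : LogBounded T
  · obtain ⟨x, hx⟩ := exists_bounded hT
    rw [ω.tracePos_eq hx, ω.tracePos_eq fun n => (hx n).trans (h1 n).symm]
  -- If the means are unbounded, both traces take the default value 0.
  · have h2 : ∀ {A : H →L[ℂ] H}, ¬ LogBounded A → ω.tracePos A = 0 := fun hA => by
      unfold tracePos
      rw [dif_neg]
      rintro ⟨K, hK⟩
      exact hA ⟨K, fun n => (Real.le_norm_self _).trans (hK n)⟩
    rw [h2 hT, h2 fun ⟨K, hK⟩ => hT ⟨K, fun n => (h1 n).symm.le.trans (hK n)⟩]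

lemma tracePos_eq_zero {T : H →L[ℂ] H} (hT : LogNegligible T) : ω.tracePos T = 0 := by
  obtain ⟨x, hx⟩ := exists_bounded hT.logBounded
  rw [ω.tracePos_eq hx]
  refine ω.eq_lim x 0 ?_
  simp_rw [hx]
  exact hT

lemma tracePos_smul {T : H →L[ℂ] H} (hT : LogBounded T) {r : ℝ} (hr : 0 ≤ r) :
    ω.tracePos ((r : ℂ) • T) = r * ω.tracePos T := by
  obtain ⟨x, hx⟩ := exists_bounded hT
  have h : ∀ n, (r • x) n = logMean ((r : ℂ) • T) n := by
    intro n
    change r • x n = _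
    rw [hx, logMean_eq, logMean_eq, smul_eq_mul,
      ← mul_div_assoc]
    congr 1
    unfold singularSum
    rw [Finset.mul_sum]
    refine Finset.sum_congr rfl fun k _ => ?_
    rw [singularValue_smul, Complex.norm_real, Real.norm_of_nonneg hr]
  rw [ω.tracePos_eq hx, ω.tracePos_eq h, map_smul, smul_eq_mul]

/-- With m = n / 2, the 2(m + 1) terms given by `le_singularSum_add` exceed the available n + 1 by
at most one, which costs ‖S + T‖; replacing log(n + 2) by log(m + 2) costs at most log 2. -/
lemma logMean_half_add_le {S T : H →L[ℂ] H} (hS : 0 ≤ S) (hT : 0 ≤ T) {K : ℝ}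
    (hK : ∀ n, logMean (S + T) n ≤ K) (n : ℕ) :
    logMean S (n / 2) + logMean T (n / 2) ≤
      logMean (S + T) n + (K * Real.log 2 + ‖S + T‖) / Real.log (((n / 2 : ℕ) : ℝ) + 2) := by
  set m := n / 2 with hm
  have hlm := log_add_two_pos m
  have hln := log_add_two_pos n
  have h1 : singularSum S (m + 1) + singularSum T (m + 1) ≤
      singularSum (S + T) (n + 1) + ‖S + T‖ := by
    calc _ ≤ singularSum (S + T) (2 * (m + 1)) := le_singularSum_add hS hT _
      _ ≤ singularSum (S + T) (n + 1 + 1) := singularSum_mono _ (by omega)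
      _ ≤ _ := by rw [singularSum_succ]; gcongr; exact singularValue_le_norm _ _
  have h2 : Real.log ((n : ℝ) + 2) ≤ Real.log 2 + Real.log ((m : ℝ) + 2) := by
    rw [← Real.log_mul (by norm_num) (by positivity)]
    refine Real.log_le_log (by positivity) ?_
    have : n ≤ 2 * m + 1 := by omega
    have : (n : ℝ) ≤ 2 * m + 1 := by exact_mod_cast this
    linarith
  have h3 : singularSum (S + T) (n + 1) =
      logMean (S + T) n * Real.log ((n : ℝ) + 2) := by
    rw [logMean_eq, div_mul_cancel₀ _ hln.ne']
  rw [logMean_eq S, logMean_eq T, ← add_div, div_le_iff₀ hlm, add_mul, div_mul_cancel₀ _ hlm.ne']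
  have h4 : logMean (S + T) n * Real.log ((n : ℝ) + 2) ≤
      logMean (S + T) n * (Real.log 2 + Real.log ((m : ℝ) + 2)) :=
    mul_le_mul_of_nonneg_left h2 (logMean_nonneg _ _)
  have h5 : logMean (S + T) n * Real.log 2 ≤ K * Real.log 2 :=
    mul_le_mul_of_nonneg_right (hK n) (Real.log_nonneg one_le_two)
  linarith

lemma tendsto_div_log_half (c : ℝ) : Filter.Tendsto
    (fun n : ℕ => c / Real.log (((n / 2 : ℕ) : ℝ) + 2)) Filter.atTop (nhds 0) := by
  have h : Filter.Tendsto (fun n : ℕ => n / 2) Filter.atTop Filter.atTop :=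
    Nat.tendsto_div_const_atTop two_ne_zero
  exact (tendsto_log_add_two.comp h).const_div_atTop c

/-- Subadditivity holds term by term. For superadditivity the sequence of S and T is replaced by its
dilation n ↦ n / 2, which ω does not see and which exceeds the sequence of S + T by at most a null
sequence. -/
lemma tracePos_add {S T : H →L[ℂ] H} (hS : 0 ≤ S) (hT : 0 ≤ T) (hSb : LogBounded S)
    (hTb : LogBounded T) : ω.tracePos (S + T) = ω.tracePos S + ω.tracePos T := by
  obtain ⟨a, ha⟩ := exists_bounded hSb
  obtain ⟨b, hb⟩ := exists_bounded hTb
  obtain ⟨s, hs⟩ := exists_bounded (hSb.add hTb)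
  obtain ⟨K, hK⟩ := hSb.add hTb
  rw [ω.tracePos_eq ha, ω.tracePos_eq hb, ω.tracePos_eq hs, ← map_add]
  refine le_antisymm (ω.toFun_mono fun n => ?_) ?_
  · rw [BoundedContinuousFunction.add_apply, ha, hb, hs, logMean_eq, logMean_eq, logMean_eq,
      ← add_div]
    exact div_le_div_of_nonneg_right (singularSum_add_le hS hT _) (log_add_two_pos n).le
  · set y : BoundedContinuousFunction ℕ ℝ :=
      (a + b).compContinuous ⟨fun n => n / 2, continuous_of_discreteTopology⟩
    rw [← ω.dilation (a + b) y fun n => rfl]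
    set err : ℕ → ℝ := fun n =>
      (K * Real.log 2 + ‖S + T‖) / Real.log (((n / 2 : ℕ) : ℝ) + 2)
    have herr : Filter.Tendsto err Filter.atTop (nhds 0) := tendsto_div_log_half _
    obtain ⟨B, hB⟩ := herr.norm.bddAbove_range
    set e : BoundedContinuousFunction ℕ ℝ :=
      BoundedContinuousFunction.ofNormedAddCommGroupDiscrete err B fun n => hB ⟨n, rfl⟩
    have he : ω.toFun e = 0 := ω.eq_lim e 0 herr
    have : ω.toFun y ≤ ω.toFun (s + e) := ω.toFun_mono fun n => by
      change (a + b) (n / 2) ≤ s n + err n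
      rw [BoundedContinuousFunction.add_apply, ha, hb, hs]
      exact logMean_half_add_le hS hT hK n
    rwa [map_add, he, add_zero] at this

/-- The Dixmier trace on selfadjoint operators. -/
def traceSA (T : H →L[ℂ] H) : ℝ := ω.tracePos T⁺ - ω.tracePos T⁻

lemma trace_eq (T : H →L[ℂ] H) : ω.trace T = (ω.traceSA (realPart T : H →L[ℂ] H) : ℂ) +
    Complex.I * (ω.traceSA (imaginaryPart T : H →L[ℂ] H) : ℂ) := rfl

end DixmierLimit

/-- T⁺T⁻ = 0 makes the two ranges orthogonal. By `singularValue_mono` the singular values of T⁺ and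
T⁻ are then at most those of T. -/
lemma norm_sq_posPart_add {T : H →L[ℂ] H} (hT : IsSelfAdjoint T) (x : H) :
    ‖T x‖ ^ 2 = ‖T⁺ x‖ ^ 2 + ‖T⁻ x‖ ^ 2 := by
  have h1 : T = T⁺ - T⁻ := (CFC.posPart_sub_negPart T hT).symm
  have h2 : inner ℂ (T⁺ x) (T⁻ x) = 0 := by
    rw [← inner_apply_apply_of_isSelfAdjoint (.of_nonneg (CFC.posPart_nonneg T))]
    have : T⁺ (T⁻ x) = (T⁺ * T⁻) x := rfl
    rw [this, CFC.posPart_mul_negPart]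
    simp
  conv_lhs => rw [h1]
  have h3 := norm_sub_sq (𝕜 := ℂ) (T⁺ x) (T⁻ x)
  rw [h2] at h3
  simpa using h3

lemma LogBounded.posPart {T : H →L[ℂ] H} (hT : LogBounded T) (hsa : IsSelfAdjoint T) :
    LogBounded T⁺ :=
  hT.of_le zero_le_one fun n => by
    rw [one_mul]
    refine singularValue_mono (fun x => ?_) n
    refine le_of_pow_le_pow_left₀ two_ne_zero (norm_nonneg _) ?_
    rw [norm_sq_posPart_add hsa]
    linarith [sq_nonneg ‖T⁻ x‖]

lemma LogBounded.negPart {T : H →L[ℂ] H} (hT : LogBounded T) (hsa : IsSelfAdjoint T) :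
    LogBounded T⁻ := by
  have : T⁻ = T⁺ - T := by
    conv_rhs => rw [← CFC.posPart_sub_negPart T hsa]
    rw [CFC.posPart_sub_negPart T hsa]
    nth_rw 3 [← CFC.posPart_sub_negPart T hsa]
    abel
  rw [this]
  exact (hT.posPart hsa).sub hT

lemma realPart_eq (T : H →L[ℂ] H) :
    (realPart T : H →L[ℂ] H) = (2⁻¹ : ℂ) • (T + star T) := by
  rw [realPart_apply_coe, ← Complex.coe_smul]
  norm_num

lemma imaginaryPart_eq (T : H →L[ℂ] H) :
    (imaginaryPart T : H →L[ℂ] H) = (2⁻¹ : ℂ) • ((-Complex.I) • (T - star T)) := by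
  rw [imaginaryPart_apply_coe, ← Complex.coe_smul, smul_comm]
  norm_num

lemma LogBounded.realPart {T : H →L[ℂ] H} (hT : LogBounded T) :
    LogBounded (realPart T : H →L[ℂ] H) := by
  rw [realPart_eq]; exact (hT.add hT.star).smul _

lemma LogBounded.imaginaryPart {T : H →L[ℂ] H} (hT : LogBounded T) :
    LogBounded (imaginaryPart T : H →L[ℂ] H) := by
  rw [imaginaryPart_eq]; exact ((hT.sub hT.star).smul _).smul _

namespace DixmierLimit

variable (ω : DixmierLimit)

/-- Written as P + B = A + N, the hypothesis falls under additivity on positive operators. Any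
decomposition may thus replace the one into positive and negative parts, which gives linearity. -/
lemma tracePos_sub_congr {A B P N : H →L[ℂ] H} (hA : 0 ≤ A) (hB : 0 ≤ B) (hP : 0 ≤ P)
    (hN : 0 ≤ N) (hAb : LogBounded A) (hBb : LogBounded B) (hPb : LogBounded P)
    (hNb : LogBounded N) (h : P - N = A - B) :
    ω.tracePos P - ω.tracePos N = ω.tracePos A - ω.tracePos B := by
  rw [sub_eq_sub_iff_add_eq_add] at h
  have h2 := congrArg ω.tracePos h
  rw [ω.tracePos_add hP hB hPb hBb, ω.tracePos_add hA hN hAb hNb] at h2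
  linarith

lemma traceSA_sub {A B : H →L[ℂ] H} (hA : 0 ≤ A) (hB : 0 ≤ B) (hAb : LogBounded A)
    (hBb : LogBounded B) : ω.traceSA (A - B) = ω.tracePos A - ω.tracePos B := by
  have hsa : IsSelfAdjoint (A - B) := (IsSelfAdjoint.of_nonneg hA).sub (.of_nonneg hB)
  have hb := hAb.sub hBb
  exact ω.tracePos_sub_congr hA hB (CFC.posPart_nonneg _) (CFC.negPart_nonneg _) hAb hBb
    (hb.posPart hsa) (hb.negPart hsa) (CFC.posPart_sub_negPart (A - B) hsa)

lemma traceSA_add {S T : H →L[ℂ] H} (hS : IsSelfAdjoint S) (hT : IsSelfAdjoint T)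
    (hSb : LogBounded S) (hTb : LogBounded T) :
    ω.traceSA (S + T) = ω.traceSA S + ω.traceSA T := by
  have h1 : S + T = (S⁺ + T⁺) - (S⁻ + T⁻) := by
    nth_rw 1 [← CFC.posPart_sub_negPart S hS, ← CFC.posPart_sub_negPart T hT]
    abel
  have p1 : 0 ≤ S⁺ := CFC.posPart_nonneg S
  have p2 : 0 ≤ T⁺ := CFC.posPart_nonneg T
  have n1 : 0 ≤ S⁻ := CFC.negPart_nonneg S
  have n2 : 0 ≤ T⁻ := CFC.negPart_nonneg T
  have b1 := hSb.posPart hS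
  have b2 := hTb.posPart hT
  have c1 := hSb.negPart hS
  have c2 := hTb.negPart hT
  rw [h1, ω.traceSA_sub (add_nonneg p1 p2) (add_nonneg n1 n2) (b1.add b2) (c1.add c2),
    ω.tracePos_add p1 p2 b1 b2, ω.tracePos_add n1 n2 c1 c2]
  unfold traceSA
  ring

lemma traceSA_smul {T : H →L[ℂ] H} (hT : IsSelfAdjoint T) (hTb : LogBounded T) (r : ℝ) :
    ω.traceSA ((r : ℂ) • T) = r * ω.traceSA T := by
  have hp := hTb.posPart hT
  have hn := hTb.negPart hT
  have hs : ∀ {A : H →L[ℂ] H} {t : ℝ}, 0 ≤ A → 0 ≤ t → 0 ≤ (t : ℂ) • A := fun hA ht =>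
    smul_nonneg (by exact_mod_cast ht) hA
  rcases le_total 0 r with hr | hr
  · have h1 : (r : ℂ) • T = (r : ℂ) • T⁺ - (r : ℂ) • T⁻ := by
      rw [← smul_sub, CFC.posPart_sub_negPart T hT]
    rw [h1, ω.traceSA_sub (hs (CFC.posPart_nonneg _) hr) (hs (CFC.negPart_nonneg _) hr)
      (hp.smul _) (hn.smul _), ω.tracePos_smul hp hr, ω.tracePos_smul hn hr]
    unfold traceSA
    ring
  · have hr' : 0 ≤ -r := by linarith
    have h1 : (r : ℂ) • T = ((-r : ℝ) : ℂ) • T⁻ - ((-r : ℝ) : ℂ) • T⁺ := by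
      rw [← smul_sub, ← neg_sub T⁺, CFC.posPart_sub_negPart T hT]
      simp
    rw [h1, ω.traceSA_sub (hs (CFC.negPart_nonneg _) hr') (hs (CFC.posPart_nonneg _) hr')
      (hn.smul _) (hp.smul _), ω.tracePos_smul hp hr', ω.tracePos_smul hn hr']
    unfold traceSA
    ring

lemma trace_add {S T : H →L[ℂ] H} (hS : LogBounded S) (hT : LogBounded T) :
    ω.trace (S + T) = ω.trace S + ω.trace T := by
  simp only [trace_eq, map_add, AddSubgroup.coe_add]
  rw [ω.traceSA_add (realPart S).2 (realPart T).2 hS.realPart hT.realPart,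
    ω.traceSA_add (imaginaryPart S).2 (imaginaryPart T).2 hS.imaginaryPart hT.imaginaryPart]
  push_cast
  ring

lemma traceSA_combination {S T : H →L[ℂ] H} (hS : IsSelfAdjoint S) (hT : IsSelfAdjoint T)
    (hSb : LogBounded S) (hTb : LogBounded T) (a b : ℝ) :
    ω.traceSA ((a : ℂ) • S + (b : ℂ) • T) = a * ω.traceSA S + b * ω.traceSA T := by
  have h : ∀ {A : H →L[ℂ] H} (t : ℝ), IsSelfAdjoint A → IsSelfAdjoint ((t : ℂ) • A) :=
    fun t hA => by
      rw [isSelfAdjoint_iff, star_smul, hA.star_eq]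
      simp
  rw [ω.traceSA_add (h a hS) (h b hT) (hSb.smul _) (hTb.smul _), ω.traceSA_smul hS hSb,
    ω.traceSA_smul hT hTb]

lemma trace_smul {T : H →L[ℂ] H} (hT : LogBounded T) (c : ℂ) :
    ω.trace (c • T) = c * ω.trace T := by
  have hT' : T = (realPart T : H →L[ℂ] H) + Complex.I • (imaginaryPart T : H →L[ℂ] H) :=
    (realPart_add_I_smul_imaginaryPart T).symm
  have hre : (realPart (c • T) : H →L[ℂ] H) = (c.re : ℂ) • (realPart T : H →L[ℂ] H) +
      ((-c.im : ℝ) : ℂ) • (imaginaryPart T : H →L[ℂ] H) := by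
    rw [realPart_smul]
    ext x
    simp [sub_eq_add_neg]
  have him : (imaginaryPart (c • T) : H →L[ℂ] H) = (c.im : ℂ) • (realPart T : H →L[ℂ] H) +
      (c.re : ℂ) • (imaginaryPart T : H →L[ℂ] H) := by
    rw [imaginaryPart_smul]
    ext x
    simp [add_comm]
  rw [trace_eq, trace_eq, hre, him,
    ω.traceSA_combination (realPart T).2 (imaginaryPart T).2 hT.realPart hT.imaginaryPart,
    ω.traceSA_combination (realPart T).2 (imaginaryPart T).2 hT.realPart hT.imaginaryPart]
  apply Complex.ext <;> simp <;> ring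

lemma trace_eq_zero {T : H →L[ℂ] H} (hT : LogNegligible T) : ω.trace T = 0 := by
  have key : ∀ {A : H →L[ℂ] H}, IsSelfAdjoint A → LogNegligible A → ω.traceSA A = 0 := by
    intro A hA hAn
    have hp : LogNegligible A⁺ := hAn.of_le (c := 1) fun n => by
      rw [one_mul]
      refine singularValue_mono (fun x => ?_) n
      refine le_of_pow_le_pow_left₀ two_ne_zero (norm_nonneg _) ?_
      rw [norm_sq_posPart_add hA]
      linarith [sq_nonneg ‖A⁻ x‖]
    have hn : LogNegligible A⁻ := hAn.of_le (c := 1) fun n => by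
      rw [one_mul]
      refine singularValue_mono (fun x => ?_) n
      refine le_of_pow_le_pow_left₀ two_ne_zero (norm_nonneg _) ?_
      rw [norm_sq_posPart_add hA]
      linarith [sq_nonneg ‖A⁺ x‖]
    simp [traceSA, ω.tracePos_eq_zero hp, ω.tracePos_eq_zero hn]
  have h1 : LogNegligible (realPart T : H →L[ℂ] H) := by
    rw [realPart_eq]; exact (hT.add hT.star).smul _
  have h2 : LogNegligible (imaginaryPart T : H →L[ℂ] H) := by
    rw [imaginaryPart_eq, sub_eq_add_neg]; exact ((hT.add hT.star.neg).smul _).smul _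
  rw [trace_eq, key (realPart T).2 h1, key (imaginaryPart T).2 h2]
  simp

lemma singularValue_unitary_conj {U : H →L[ℂ] H} (hU : U ∈ unitary (H →L[ℂ] H))
    (T : H →L[ℂ] H) (n : ℕ) : singularValue (U * T * star U) n = singularValue T n := by
  have hn : ∀ {V : H →L[ℂ] H}, V ∈ unitary (H →L[ℂ] H) → ‖V‖ ≤ 1 := fun {V} hV => by
    rcases subsingleton_or_nontrivial (H →L[ℂ] H) with h | h
    · simp [Subsingleton.elim V (0 : H →L[ℂ] H)]
    · exact (CStarRing.norm_of_mem_unitary hV).le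
  have key : ∀ (V : H →L[ℂ] H), V ∈ unitary (H →L[ℂ] H) → ∀ A : H →L[ℂ] H,
      singularValue (V * A * star V) n ≤ singularValue A n := by
    intro V hV A
    have h0 := singularValue_nonneg A n
    calc _ ≤ singularValue (V * A) n * ‖star V‖ := singularValue_mul_right_le _ _ _
      _ ≤ (‖V‖ * singularValue A n) * ‖star V‖ := by
          gcongr; exact singularValue_mul_left_le _ _ _
      _ ≤ (1 * singularValue A n) * 1 := by
          gcongr
          · exact hn hV
          · exact hn (Unitary.star_mem hV)
      _ = _ := by ring
  refine le_antisymm (key U hU T) ?_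
  have h := key (star U) (Unitary.star_mem hU) (U * T * star U)
  have e : star U * (U * T * star U) * star (star U) = T := by
    rw [star_star]
    calc _ = (star U * U) * T * (star U * U) := by noncomm_ring
      _ = T := by rw [Unitary.star_mul_self_of_mem hU, one_mul, mul_one]
  rwa [e] at h

lemma traceSA_unitary_conj {U : H →L[ℂ] H} (hU : U ∈ unitary (H →L[ℂ] H)) {T : H →L[ℂ] H}
    (hT : IsSelfAdjoint T) (hTb : LogBounded T) :
    ω.traceSA (U * T * star U) = ω.traceSA T := by
  have h1 : U * T * star U = U * T⁺ * star U - U * T⁻ * star U := by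
    rw [← sub_mul, ← mul_sub, CFC.posPart_sub_negPart T hT]
  rw [h1, ω.traceSA_sub (star_right_conjugate_nonneg (CFC.posPart_nonneg T) U)
    (star_right_conjugate_nonneg (CFC.negPart_nonneg T) U)
    (((hTb.posPart hT).mul_left U).mul_right _) (((hTb.negPart hT).mul_left U).mul_right _),
    ω.tracePos_congr (singularValue_unitary_conj hU T⁺),
    ω.tracePos_congr (singularValue_unitary_conj hU T⁻)]
  rfl

lemma trace_unitary_conj {U : H →L[ℂ] H} (hU : U ∈ unitary (H →L[ℂ] H)) {T : H →L[ℂ] H}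
    (hT : LogBounded T) : ω.trace (U * T * star U) = ω.trace T := by
  have h1 : (realPart (U * T * star U) : H →L[ℂ] H) = U * (realPart T : H →L[ℂ] H) * star U := by
    simp only [realPart_eq, star_mul, star_star, mul_smul_comm, smul_mul_assoc, mul_add, add_mul,
      mul_assoc]
  have h2 : (imaginaryPart (U * T * star U) : H →L[ℂ] H) =
      U * (imaginaryPart T : H →L[ℂ] H) * star U := by
    simp only [imaginaryPart_eq, star_mul, star_star, mul_smul_comm, smul_mul_assoc, mul_sub,
      sub_mul, mul_assoc]
  rw [trace_eq, trace_eq, h1, h2, ω.traceSA_unitary_conj hU (realPart T).2 hT.realPart,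
    ω.traceSA_unitary_conj hU (imaginaryPart T).2 hT.imaginaryPart]

/-- The Dixmier trace vanishes on commutators of bounded operators with the Dixmier ideal. -/
lemma trace_mul_comm {T : H →L[ℂ] H} (hT : LogBounded T) (A : H →L[ℂ] H) :
    ω.trace (A * T) = ω.trace (T * A) := by
  -- Unitaries span the algebra, and for a unitary U the operator UT = U(TU)U* is a unitary
  -- conjugate of TU.
  have hA : A ∈ Submodule.span ℂ (unitary (H →L[ℂ] H) : Set (H →L[ℂ] H)) := by
    rw [CStarAlgebra.span_unitary]; trivial
  induction hA using Submodule.span_induction with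
  | mem U hU =>
    have h := ω.trace_unitary_conj hU (hT.mul_right U)
    have e : U * (T * U) * star U = U * T := by
      calc _ = U * T * (U * star U) := by noncomm_ring
        _ = _ := by rw [Unitary.mul_star_self_of_mem hU, mul_one]
    rwa [e] at h
  | zero => simp
  | add A B _ _ hA hB =>
    rw [add_mul, mul_add, ω.trace_add (hT.mul_left A) (hT.mul_left B),
      ω.trace_add (hT.mul_right A) (hT.mul_right B), hA, hB]
  | smul c A _ hA =>
    rw [smul_mul_assoc, mul_smul_comm, ω.trace_smul (hT.mul_left A), ω.trace_smul (hT.mul_right A),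
      hA]

end DixmierLimit

end DixmierTrace

/-! ### The operator ⟨D⟩⁻¹ and its commutators. -/

section RegularizedInverse

variable {H : Type*} [NormedAddCommGroup H] [InnerProductSpace ℂ H] [CompleteSpace H]

lemma inner_symm_of_isSelfAdjoint {D : H →ₗ.[ℂ] H} (hD : IsSelfAdjoint D) (x y : D.domain) :
    inner ℂ (D x) (y : H) = inner ℂ (x : H) (D y) := by
  have h := LinearPMap.adjoint_isFormalAdjoint hD.dense_domain
  rw [show D.adjoint = D from hD] at h
  exact h x y

lemma nonneg_of_inner {T : H →L[ℂ] H} (h : ∀ x, ∃ r : ℝ, 0 ≤ r ∧ inner ℂ (T x) x = (r : ℂ)) :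
    0 ≤ T := by
  rw [ContinuousLinearMap.nonneg_iff_isPositive, ContinuousLinearMap.isPositive_iff_complex]
  intro x
  obtain ⟨r, hr, hx⟩ := h x
  rw [hx]
  exact ⟨by simp, by simpa using hr⟩

/-- With R the resolvent, f = Rf + D²Rf and the symmetry of D give ⟨Rf, f⟩ = ‖Rf‖² + ‖DRf‖². -/
lemma resolventSq_nonneg {D : H →ₗ.[ℂ] H} (hD : IsSelfAdjoint D) : 0 ≤ resolventSq D := by
  refine nonneg_of_inner fun f => ?_
  obtain ⟨h, h', hf⟩ := resolventSq_spec hD f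
  refine ⟨‖resolventSq D f‖ ^ 2 + ‖D ⟨resolventSq D f, h⟩‖ ^ 2, by positivity, ?_⟩
  have h1 := inner_symm_of_isSelfAdjoint hD ⟨resolventSq D f, h⟩ ⟨_, h'⟩
  nth_rw 2 [← hf]
  rw [inner_add_right, ← h1, inner_self_eq_ofReal, inner_self_eq_ofReal]
  push_cast
  rfl

/-- Here (1 − R)f = D²Rf, so the form is ‖DRf‖² + ‖D²Rf‖². -/
lemma one_sub_resolventSq_nonneg {D : H →ₗ.[ℂ] H} (hD : IsSelfAdjoint D) :
    0 ≤ 1 - resolventSq D := by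
  refine nonneg_of_inner fun f => ?_
  obtain ⟨h, h', hf⟩ := resolventSq_spec hD f
  refine ⟨‖D ⟨resolventSq D f, h⟩‖ ^ 2 + ‖D ⟨_, h'⟩‖ ^ 2, by positivity, ?_⟩
  have h1 := inner_symm_of_isSelfAdjoint hD ⟨_, h'⟩ ⟨resolventSq D f, h⟩
  have h2 : (1 - resolventSq D) f = D ⟨_, h'⟩ := by
    rw [sub_apply, one_apply_eq_self, sub_eq_iff_eq_add, add_comm]
    exact hf.symm
  have h3 : inner ℂ ((1 - resolventSq D) f) f =
      inner ℂ (D ⟨_, h'⟩) (resolventSq D f + D ⟨_, h'⟩) := by rw [h2, hf]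
  rw [h3, inner_add_right, h1, inner_self_eq_ofReal, inner_self_eq_ofReal]
  push_cast
  rfl

lemma regInv_isSelfAdjoint (D : H →ₗ.[ℂ] H) : IsSelfAdjoint (regInv D) :=
  .of_nonneg (CFC.sqrt_nonneg _)

lemma regInv_mul_self {D : H →ₗ.[ℂ] H} (hD : IsSelfAdjoint D) :
    regInv D * regInv D = resolventSq D :=
  (sqrt_props (resolventSq_nonneg hD)).2

lemma resolventSq_injective {D : H →ₗ.[ℂ] H} (hD : IsSelfAdjoint D) {f : H}
    (hf : resolventSq D f = 0) : f = 0 := by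
  obtain ⟨h, h', e⟩ := resolventSq_spec hD f
  have h1 : (⟨resolventSq D f, h⟩ : D.domain) = 0 := Subtype.ext hf
  have h2 : D ⟨resolventSq D f, h⟩ = 0 := by rw [h1, LinearPMap.map_zero]
  have h3 : (⟨D ⟨resolventSq D f, h⟩, h'⟩ : D.domain) = 0 := Subtype.ext h2
  rw [h3, LinearPMap.map_zero, hf, add_zero] at e
  exact e.symm

/-- This injectivity gives the partial inverse in `absOp` its meaning. -/
lemma regInv_ker {D : H →ₗ.[ℂ] H} (hD : IsSelfAdjoint D) :
    ((regInv D).toLinearMap.toPMap ⊤).toFun.ker = ⊥ := by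
  rw [LinearMap.ker_eq_bot']
  rintro ⟨x, hx⟩ h
  have h1 : regInv D x = 0 := h
  refine Subtype.ext (resolventSq_injective hD ?_)
  rw [← regInv_mul_self hD, mul_apply_eq_comp, h1, map_zero]

lemma mem_absOp_domain {D : H →ₗ.[ℂ] H} {x : H} :
    x ∈ (absOp D).domain ↔ ∃ y, regInv D y = x := by
  have : (absOp D).domain = LinearMap.range ((regInv D).toLinearMap.toPMap ⊤).toFun :=
    LinearPMap.inverse_domain
  rw [this]
  exact ⟨fun ⟨y, hy⟩ => ⟨y, hy⟩, fun ⟨y, hy⟩ => ⟨⟨y, trivial⟩, hy⟩⟩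

lemma absOp_apply {D : H →ₗ.[ℂ] H} (hD : IsSelfAdjoint D) {y : H} (x : (absOp D).domain)
    (hx : (x : H) = regInv D y) : absOp D x = CFC.sqrt (1 - resolventSq D) y := by
  have h := LinearPMap.inverse_apply_eq (regInv_ker hD) (y := x) (x := ⟨y, trivial⟩) hx.symm
  change CFC.sqrt (1 - resolventSq D)
    (((regInv D).toLinearMap.toPMap ⊤).inverse x) = _
  rw [h]

/-- If the commutator of `T` with `|D|` is bounded, then `[⟨D⟩⁻¹, T]` is of order `-2`. -/
lemma exists_mul_regInv_eq {D : H →ₗ.[ℂ] H} (hD : IsSelfAdjoint D) {T S : H →L[ℂ] H}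
    (h : HasCommutator (absOp D) T S) :
    ∃ S' : H →L[ℂ] H, T * regInv D = regInv D * T + regInv D * S' * regInv D := by
  set L := regInv D with hL
  set b := CFC.sqrt (1 - resolventSq D) with hb
  have hbb : b * b = 1 - resolventSq D := (sqrt_props (one_sub_resolventSq_nonneg hD)).2
  have hb0 : 0 ≤ b := CFC.sqrt_nonneg _
  have hLL : L * L = resolventSq D := regInv_mul_self hD
  have hcomm : Commute b L := by
    have h1 : Commute (resolventSq D) L := by
      rw [← hLL]; exact (Commute.refl L).mul_left (Commute.refl L)
    have h2 : Commute (1 - resolventSq D) L := (Commute.one_left L).sub_left h1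
    exact h2.cfcₙ_nnreal _
  have hunit : IsUnit (1 + b) := CStarAlgebra.isUnit_of_le 1 (le_add_of_nonneg_right hb0)
  obtain ⟨u, hu⟩ := hunit
  have hcomm' : Commute ((u⁻¹ : (H →L[ℂ] H)ˣ) : H →L[ℂ] H) L := by
    refine Commute.units_inv_left ?_
    rw [hu]
    exact (Commute.one_left L).add_left hcomm
  -- Here b = |D|L, and L² = 1 − b² gives KL = 1 − b: thus K is the bounded operator ⟨D⟩ − |D|.
  set K := L * ((u⁻¹ : (H →L[ℂ] H)ˣ) : H →L[ℂ] H) with hK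
  have hfac : L * L = (u : H →L[ℂ] H) * (1 - b) := by
    rw [hu, hLL, add_mul, mul_sub, one_mul, one_mul, mul_sub, mul_one, hbb]
    abel
  have hKL : K * L = 1 - b := by
    rw [hK, ← hcomm'.eq, mul_assoc, hfac, Units.inv_mul_cancel_left]
  -- This is [⟨D⟩, T], that is, [|D|, T] + [K, T].
  refine ⟨S - T * K + K * T, ?_⟩
  ext x
  have hxd : L x ∈ (absOp D).domain := mem_absOp_domain.2 ⟨x, rfl⟩
  obtain ⟨hT, hS⟩ := h ⟨L x, hxd⟩
  obtain ⟨y, hy⟩ := mem_absOp_domain.1 hT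
  rw [absOp_apply hD ⟨T (L x), hT⟩ hy.symm, absOp_apply hD ⟨L x, hxd⟩ rfl] at hS
  have hy' : L y = T (L x) := hy
  have e1 : y = b y + K (L y) := by
    have := congrArg (fun A : H →L[ℂ] H => A y) hKL
    simp only [mul_apply_eq_comp, sub_apply, one_apply_eq_self] at this
    rw [this]; abel
  have e2 : T x = T (b x) + T (K (L x)) := by
    have := congrArg (fun A : H →L[ℂ] H => A x) hKL
    simp only [mul_apply_eq_comp, sub_apply, one_apply_eq_self] at this
    rw [this, map_sub]; abel
  -- As y = ⟨D⟩TLx, this reads ⟨D⟩T = T⟨D⟩ + S' on the range of L; applying L yields the claim.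
  have e3 : y = T x + (S - T * K + K * T) (L x) := by
    simp only [add_apply, sub_apply, mul_apply_eq_comp]
    rw [e2, ← hy']
    nth_rw 1 [e1]
    rw [← sub_eq_iff_eq_add'.2 (sub_eq_iff_eq_add.1 hS)]
    abel
  have e4 : T (L x) = L y := hy'.symm
  simp only [add_apply, mul_apply_eq_comp] at e3 ⊢
  nth_rw 1 [e4]
  nth_rw 1 [e3]
  rw [map_add]

/-- T is moved past one factor L at a time. Every correction carries n + 1 factors L, one more than
the power itself. -/
lemma mul_pow_eq_of_mul_eq {R : Type*} [Ring R] {L T S : R} (h : T * L = L * T + L * S * L)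
    (n : ℕ) : T * L ^ n = L ^ n * T + ∑ j ∈ Finset.range n, L ^ (j + 1) * S * L ^ (n - j) := by
  induction n with
  | zero => simp
  | succ n ih =>
    have h1 : ∑ j ∈ Finset.range (n + 1), L ^ (j + 1) * S * L ^ (n + 1 - j) =
        (∑ j ∈ Finset.range n, L ^ (j + 1) * S * L ^ (n - j)) * L + L ^ (n + 1) * S * L := by
      rw [Finset.sum_range_succ, Finset.sum_mul]
      congr 1
      · refine Finset.sum_congr rfl fun j hj => ?_
        have : n + 1 - j = (n - j) + 1 := by have := Finset.mem_range.1 hj; omega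
        rw [this, pow_succ L (n - j)]
        simp only [mul_assoc]
      · simp
    rw [h1, pow_succ, ← mul_assoc, ih, add_mul, mul_assoc (L ^ n), h]
    noncomm_ring

/-- By monotonicity, (n + 1) times the n-th singular value is at most the sum up to n, which is
O(log n). -/
lemma LogBounded.tendsto_singularValue {T : H →L[ℂ] H} (hT : LogBounded T) :
    Filter.Tendsto (singularValue T) Filter.atTop (nhds 0) := by
  obtain ⟨K, hK⟩ := hT
  have h1 : ∀ n : ℕ, singularValue T n ≤ K * (Real.log ((n : ℝ) + 2) / ((n : ℝ) + 1)) := by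
    intro n
    have h2 : ((n : ℝ) + 1) * singularValue T n ≤ singularSum T (n + 1) := by
      calc ((n : ℝ) + 1) * singularValue T n
          = ∑ k ∈ Finset.range (n + 1), singularValue T n := by simp
        _ ≤ _ := Finset.sum_le_sum fun k hk =>
          singularValue_antitone T (by have := Finset.mem_range.1 hk; omega)
    have h3 : singularSum T (n + 1) ≤ K * Real.log ((n : ℝ) + 2) := by
      have := hK n
      rwa [logMean_eq, div_le_iff₀ (log_add_two_pos n)] at this
    rw [← mul_div_assoc, le_div_iff₀ (by positivity)]
    linarith
  refine squeeze_zero (singularValue_nonneg T) h1 ?_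
  have h4 : Filter.Tendsto (fun x : ℝ => Real.log x / (x - 1)) Filter.atTop (nhds 0) := by
    have h5 := Real.isLittleO_log_id_atTop.tendsto_div_nhds_zero
    have h6 : Filter.Tendsto (fun x : ℝ => x / (x - 1)) Filter.atTop (nhds 1) := by
      have : Filter.Tendsto (fun x : ℝ => 1 + 1 / (x - 1)) Filter.atTop (nhds (1 + 0)) :=
        tendsto_const_nhds.add (tendsto_const_nhds.div_atTop
          (Filter.tendsto_atTop_add_const_right _ _ Filter.tendsto_id))
      rw [add_zero] at this
      refine this.congr' ?_
      filter_upwards [Filter.eventually_gt_atTop 1] with x hx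
      have : x - 1 ≠ 0 := by linarith
      field_simp
      ring
    have h7 := h5.mul h6
    rw [zero_mul] at h7
    refine h7.congr' ?_
    filter_upwards [Filter.eventually_gt_atTop 1] with x hx
    have : x ≠ 0 := by linarith
    simp only [id]
    field_simp
  have h8 := (h4.comp (Filter.tendsto_atTop_add_const_right _ (2 : ℝ)
    tendsto_natCast_atTop_atTop)).const_mul K
  rw [mul_zero] at h8
  refine h8.congr fun n => ?_
  simp only [Function.comp]
  congr 2
  ring

/-- A weighted mean of a null sequence. -/
lemma logNegligible_of_le {G T : H →L[ℂ] H} (hG : LogBounded G) {f : ℕ → ℝ} (hf0 : ∀ k, 0 ≤ f k)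
    (hf : Filter.Tendsto f Filter.atTop (nhds 0)) {r : ℕ} (hr : 0 < r) {c : ℝ} (hc : 0 ≤ c)
    (h : ∀ k, singularValue T (r * k) ≤ c * (f k * singularValue G k)) : LogNegligible T := by
  obtain ⟨K, hK⟩ := hG
  have hK0 : 0 ≤ K := (logMean_nonneg G 0).trans (hK 0)
  have hsum : ∀ n : ℕ, singularSum T (n + 1) ≤
      r * c * ∑ k ∈ Finset.range (n + 1), f k * singularValue G k := by
    intro n
    calc singularSum T (n + 1) ≤ singularSum T (r * (n + 1)) :=
          singularSum_mono T (Nat.le_mul_of_pos_left _ hr)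
      _ ≤ r * ∑ k ∈ Finset.range (n + 1), singularValue T (r * k) := singularSum_mul_le T r _
      _ ≤ r * ∑ k ∈ Finset.range (n + 1), c * (f k * singularValue G k) := by
          gcongr with k; exact h k
      _ = _ := by rw [← Finset.mul_sum]; ring
  refine Metric.tendsto_atTop.2 fun ε hε => ?_
  -- Chosen so that r·c·K·η ≤ ε / 2; the + 1 keeps the denominator positive.
  set η : ℝ := ε / (2 * (r * c * K + 1)) with hη
  have hden : 0 < r * c * K + 1 := by positivity
  have hη0 : 0 < η := by positivity
  obtain ⟨N, hN⟩ := Metric.tendsto_atTop.1 hf η hη0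
  -- The terms below N contribute a constant, which division by the logarithm sends to zero.
  set B := r * c * ∑ k ∈ Finset.range N, f k * singularValue G k with hB
  have hlog : Filter.Tendsto (fun n : ℕ => B / Real.log ((n : ℝ) + 2)) Filter.atTop (nhds 0) :=
    tendsto_log_add_two.const_div_atTop B
  obtain ⟨N', hN'⟩ := Metric.tendsto_atTop.1 hlog (ε / 2) (by positivity)
  refine ⟨N', fun n hn => ?_⟩
  have hln := log_add_two_pos n
  rw [Real.dist_eq, sub_zero, abs_of_nonneg (logMean_nonneg T n)]
  have h1 : ∑ k ∈ Finset.range (n + 1), f k * singularValue G k ≤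
      ∑ k ∈ Finset.range N, f k * singularValue G k + η * singularSum G (n + 1) := by
    have h2 : ∀ m, ∑ k ∈ Finset.range m, f k * singularValue G k ≤
        ∑ k ∈ Finset.range N, f k * singularValue G k + η * singularSum G m := by
      intro m
      rcases le_total m N with hm | hm
      · have := Finset.sum_le_sum_of_subset_of_nonneg (f := fun k => f k * singularValue G k)
          (Finset.range_mono hm) fun k _ _ => mul_nonneg (hf0 k) (singularValue_nonneg G k)
        have := mul_nonneg hη0.le (singularSum_nonneg G m)
        linarith
      · rw [← Finset.sum_range_add_sum_Ico _ hm]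
        gcongr
        calc ∑ k ∈ Finset.Ico N m, f k * singularValue G k
            ≤ ∑ k ∈ Finset.Ico N m, η * singularValue G k := by
              refine Finset.sum_le_sum fun k hk => ?_
              have h3 := hN k (Finset.mem_Ico.1 hk).1
              rw [Real.dist_eq, sub_zero, abs_of_nonneg (hf0 k)] at h3
              exact mul_le_mul_of_nonneg_right h3.le (singularValue_nonneg G k)
          _ = η * ∑ k ∈ Finset.Ico N m, singularValue G k := by rw [Finset.mul_sum]
          _ ≤ η * singularSum G m := by
              gcongr
              unfold singularSum
              rw [← Finset.sum_range_add_sum_Ico _ hm]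
              linarith [singularSum_nonneg G N, show singularSum G N =
                ∑ k ∈ Finset.range N, singularValue G k from rfl]
    exact h2 _
  have h3 : B / Real.log ((n : ℝ) + 2) < ε / 2 := by
    have := hN' n hn
    rw [Real.dist_eq, sub_zero] at this
    exact (le_abs_self _).trans_lt this
  have h4 : logMean T n ≤ B / Real.log ((n : ℝ) + 2) + r * c * η * logMean G n := by
    rw [logMean_eq, logMean_eq, ← mul_div_assoc, ← add_div]
    refine div_le_div_of_nonneg_right ?_ hln.le
    have := mul_le_mul_of_nonneg_left h1 (show 0 ≤ r * c by positivity)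
    have := hsum n
    rw [hB]
    linarith
  have h5 : r * c * η * logMean G n ≤ ε / 2 := by
    calc r * c * η * logMean G n ≤ r * c * η * K := by
          gcongr; exact hK n
      _ = (r * c * K) * η := by ring
      _ ≤ (r * c * K + 1) * η := by gcongr; linarith
      _ = ε / 2 := by rw [hη]; field_simp
  linarith

lemma tendsto_singularValue_of_pow {L : H →L[ℂ] H} (hL : IsSelfAdjoint L) {p : ℕ}
    (h : LogBounded (L ^ (p + 1))) :
    Filter.Tendsto (singularValue L) Filter.atTop (nhds 0) := by
  refine Metric.tendsto_atTop.2 fun ε hε => ?_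
  obtain ⟨N, hN⟩ := Metric.tendsto_atTop.1 h.tendsto_singularValue (ε ^ (p + 1)) (by positivity)
  refine ⟨N, fun n hn => ?_⟩
  have h1 := hN n hn
  rw [Real.dist_eq, sub_zero, abs_of_nonneg (singularValue_nonneg _ _)] at h1 ⊢
  exact lt_of_pow_lt_pow_left₀ (p + 1) hε.le ((singularValue_pow_le hL p n).trans_lt h1)

/-- Operators of order `-(p + 2)` are negligible when those of order `-(p + 1)` are in the
Dixmier ideal. -/
lemma logNegligible_pow_mul_pow {L : H →L[ℂ] H} (hL : IsSelfAdjoint L) {p : ℕ}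
    (h : LogBounded (L ^ (p + 1))) (S : H →L[ℂ] H) {i j : ℕ} (hij : i + j = p + 2) :
    LogNegligible (L ^ i * S * L ^ j) := by
  -- r = p + 3 counts the factors: p + 2 copies of L and one S. One singular value of L tends to
  -- zero; the other p + 1 are bounded by the singular value of the power.
  refine logNegligible_of_le h (singularValue_nonneg L) (tendsto_singularValue_of_pow hL h)
    (r := p + 3) (Nat.succ_pos _) (norm_nonneg S) fun k => ?_
  have h1 := singularValue_list_prod_le (List.replicate i L ++ [S] ++ List.replicate j L) k
  simp only [List.prod_append, List.prod_replicate, List.prod_singleton, List.length_append,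
    List.length_replicate, List.length_singleton, List.map_append, List.map_replicate,
    List.map_cons, List.map_nil] at h1
  rw [show i + 1 + j = p + 3 by omega] at h1
  refine h1.trans ?_
  have h0 := singularValue_nonneg L k
  have h00 := singularValue_nonneg S k
  calc singularValue L k ^ i * singularValue S k * singularValue L k ^ j
      = singularValue S k * singularValue L k ^ (i + j) := by rw [pow_add]; ring
    _ = singularValue S k * (singularValue L k * singularValue L k ^ (p + 1)) := by
        rw [hij]; ring
    _ ≤ _ := by
        gcongr
        · exact singularValue_le_norm S k
        · exact singularValue_pow_le hL p k

lemma logNegligible_commutator_regInv_pow {D : H →ₗ.[ℂ] H} (hD : IsSelfAdjoint D) {p : ℕ}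
    (hp : 0 < p) (hsum : LogBounded (regInv D ^ p)) {T S : H →L[ℂ] H}
    (h : HasCommutator (absOp D) T S) :
    LogNegligible (T * regInv D ^ p - regInv D ^ p * T) := by
  obtain ⟨q, rfl⟩ := Nat.exists_eq_succ_of_ne_zero hp.ne'
  obtain ⟨S', hS'⟩ := exists_mul_regInv_eq hD h
  rw [mul_pow_eq_of_mul_eq hS', add_sub_cancel_left]
  refine LogNegligible.sum _ fun j hj => ?_
  refine logNegligible_pow_mul_pow (regInv_isSelfAdjoint D) hsum S' ?_
  have := Finset.mem_range.1 hj
  omega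

end RegularizedInverse

/-! ### The functional ψ_ω is a trace on 𝒞. -/

section TraceProperty

variable {H : Type*} [NormedAddCommGroup H] [InnerProductSpace ℂ H] [CompleteSpace H]

namespace SpectralTriple

variable (X : SpectralTriple H)

/-- Commutation with L^p is a derivation and negligible operators are stable under sums, adjoints
and bounded multiples on either side, so only the generators matter; there regularity with m = 1
suffices. -/
lemma logNegligible_cliff (hreg : X.IsQCInfty) {p : ℕ} (hp : 0 < p) (hsum : X.IsZpSummable p)
    {w : H →L[ℂ] H} (hw : w ∈ X.cliff) :
    LogNegligible (w * regInv X.D ^ p - regInv X.D ^ p * w) := by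
  have hG : star (regInv X.D ^ p) = regInv X.D ^ p := ((regInv_isSelfAdjoint X.D).pow p).star_eq
  have hb : LogBounded (regInv X.D ^ p) := hsum.2
  induction hw using StarAlgebra.adjoin_induction with
  | mem x hx =>
    have : ∃ S, HasCommutator (absOp X.D) x S := by
      rcases hx with hx | ⟨a, ha, rfl⟩
      · obtain ⟨S, hS, -⟩ := (hreg x hx 1).1
        exact ⟨S, hS⟩
      · obtain ⟨S, hS, -⟩ := (hreg a ha 1).2
        exact ⟨S, hS⟩
    obtain ⟨S, hS⟩ := this
    exact logNegligible_commutator_regInv_pow X.selfAdjoint hp hb hS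
  | algebraMap r =>
    rw [← Algebra.commutes r (regInv X.D ^ p), sub_self]
    exact LogNegligible.zero
  | add x y _ _ hx hy =>
    have := hx.add hy
    convert this using 1
    noncomm_ring
  | mul x y _ _ hx hy =>
    have := (hx.mul_right y).add (hy.mul_left x)
    convert this using 1
    noncomm_ring
  | star x _ hx =>
    have := hx.star.neg
    convert this using 1
    rw [star_sub, star_mul, star_mul, hG]
    noncomm_ring

/-- The functional `ψ_ω` is a trace on the Clifford algebra. -/
lemma psi_mul_comm (hreg : X.IsQCInfty) {p : ℕ} (hp : 0 < p) (hsum : X.IsZpSummable p)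
    (ω : DixmierLimit) (u : H →L[ℂ] H) {v : H →L[ℂ] H} (hv : v ∈ X.cliff) :
    X.psi ω p (u * v) = X.psi ω p (v * u) := by
  unfold psi
  set G := regInv X.D ^ p with hG
  have hb : LogBounded G := hsum.2
  have hn := (X.logNegligible_cliff hreg hp hsum hv).mul_left u
  -- Move v past G at the cost of a negligible term, then cycle it to the front.
  have e : u * v * G = u * (v * G - G * v) + (u * G) * v := by noncomm_ring
  rw [e, ω.trace_add hn.logBounded ((hb.mul_left u).mul_right v), ω.trace_eq_zero hn, zero_add,
    ← ω.trace_mul_comm (hb.mul_left u) v, mul_assoc]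

end SpectralTriple

end TraceProperty

/-! ### Density of the smooth domain. -/

section SmoothDomain

variable {H : Type*} [NormedAddCommGroup H] [InnerProductSpace ℂ H] [CompleteSpace H]

lemma mem_domPow_succ {D : H →ₗ.[ℂ] H} {k : ℕ} {x : H} :
    x ∈ domPow D (k + 1) ↔ ∃ h : x ∈ D.domain, D ⟨x, h⟩ ∈ domPow D k := by
  constructor
  · rintro ⟨y, hy, rfl⟩
    exact ⟨y.2, hy⟩
  · rintro ⟨h, hx⟩
    exact ⟨⟨x, h⟩, hx, rfl⟩

/-- The eigenvalue equation puts x and Dx in Dom D with D²x = (c⁻¹ − 1)x, so membership of x and of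
Dx in Dom Dᵏ propagates jointly in k. -/
lemma mem_smoothDom_of_eigenvector {D : H →ₗ.[ℂ] H} (hD : IsSelfAdjoint D) {x : H} {c : ℂ}
    (hc : c ≠ 0) (hx : resolventSq D x = c • x) : x ∈ smoothDom D := by
  obtain ⟨h, h', e⟩ := resolventSq_spec hD x
  have hxd : x ∈ D.domain := by
    have := D.domain.smul_mem c⁻¹ h
    rwa [hx, inv_smul_smul₀ hc] at this
  have h1 : D ⟨resolventSq D x, h⟩ = c • D ⟨x, hxd⟩ := by
    rw [← LinearPMap.map_smul]
    congr 1
    exact Subtype.ext hx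
  have hDd : D ⟨x, hxd⟩ ∈ D.domain := by
    have := D.domain.smul_mem c⁻¹ h'
    rwa [h1, inv_smul_smul₀ hc] at this
  have h2 : D ⟨D ⟨resolventSq D x, h⟩, h'⟩ = c • D ⟨D ⟨x, hxd⟩, hDd⟩ := by
    rw [← LinearPMap.map_smul]
    congr 1
    exact Subtype.ext h1
  have h3 : D ⟨D ⟨x, hxd⟩, hDd⟩ = (c⁻¹ * (1 - c)) • x := by
    rw [h2, hx] at e
    have : c • D ⟨D ⟨x, hxd⟩, hDd⟩ = (1 - c) • x := by
      rw [sub_smul, one_smul]; exact eq_sub_of_add_eq' e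
    rw [mul_smul, ← this, inv_smul_smul₀ hc]
  have key : ∀ k, x ∈ domPow D k ∧ D ⟨x, hxd⟩ ∈ domPow D k := by
    intro k
    induction k with
    | zero => exact ⟨trivial, trivial⟩
    | succ k ih =>
      refine ⟨mem_domPow_succ.2 ⟨hxd, ih.2⟩, mem_domPow_succ.2 ⟨hDd, ?_⟩⟩
      rw [h3]
      exact Submodule.smul_mem _ _ ih.1
  exact Submodule.mem_iInf _ |>.2 fun k => (key k).1

/-- The compact selfadjoint operator (1 + D²)⁻¹ is injective, so its eigenvectors with nonzero
eigenvalue, which are smooth, span a dense subspace. -/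
lemma dense_smoothDom {D : H →ₗ.[ℂ] H} (hD : IsSelfAdjoint D)
    (hc : IsCompactOperator (regInv D)) : Dense (smoothDom D : Set H) := by
  have hcomp : IsCompactOperator (resolventSq D) := by
    rw [← regInv_mul_self hD]
    exact hc.comp_clm (regInv D)
  have hsymm : (resolventSq D).IsSymmetric :=
    (IsSelfAdjoint.of_nonneg (resolventSq_nonneg hD)).isSymmetric
  have h := ContinuousLinearMap.orthogonalComplement_iSup_eigenspaces_eq_bot hcomp hsymm
  have hle : (⨆ μ, Module.End.eigenspace (resolventSq D : Module.End ℂ H) μ) ≤ smoothDom D := by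
    refine iSup_le fun μ x hx => ?_
    have hx' : resolventSq D x = μ • x := Module.End.mem_eigenspace_iff.1 hx
    rcases eq_or_ne μ 0 with rfl | hμ
    · rw [zero_smul] at hx'
      rw [resolventSq_injective hD hx']
      exact Submodule.zero_mem _
    · exact mem_smoothDom_of_eigenvector hD hμ hx'
  rw [Submodule.dense_iff_topologicalClosure_eq_top, Submodule.topologicalClosure_eq_top_iff,
    eq_bot_iff, ← h]
  exact Submodule.orthogonal_le hle

end SmoothDomain

/-! ### How ε and C act on 𝒞 by conjugation. -/

section Symmetries

variable {H : Type*} [NormedAddCommGroup H] [InnerProductSpace ℂ H] [CompleteSpace H]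

namespace SpectralTriple

variable (X : SpectralTriple H)

lemma hasCommutator_commutator {a : H →L[ℂ] H} (ha : a ∈ X.alg) :
    HasCommutator X.D a (commutator X.D a) := by
  have h := X.exists_commutator a ha
  unfold commutator
  rw [dif_pos h]
  exact h.choose_spec

/-- A bounded operator that commutes with the algebra and commutes with `D` up to a scalar commutes
with the commutators `[D, a]` up to the same scalar. -/
lemma mul_commutator_eq {T : H →L[ℂ] H} {s : ℂ}
    (hT : ∀ x : X.D.domain, ∃ h : T x ∈ X.D.domain, T (X.D x) = s • X.D ⟨T x, h⟩)
    {a : H →L[ℂ] H} (ha : a ∈ X.alg) (hTa : T * a = a * T) :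
    T * commutator X.D a = s • (commutator X.D a * T) := by
  have hS := X.hasCommutator_commutator ha
  refine ContinuousLinearMap.coeFn_injective (Continuous.ext_on X.dense_domain
    (T * commutator X.D a).continuous (s • (commutator X.D a * T)).continuous ?_)
  intro x hx
  have hcomm : ∀ y, T (a y) = a (T y) := fun y => congrArg (fun A : H →L[ℂ] H => A y) hTa
  obtain ⟨hax, e1⟩ := hS ⟨x, hx⟩
  obtain ⟨hTx, e2⟩ := hT ⟨x, hx⟩
  obtain ⟨hTax, e3⟩ := hT ⟨a x, hax⟩
  obtain ⟨haTx, e4⟩ := hS ⟨T x, hTx⟩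
  have e5 : X.D ⟨T (a x), hTax⟩ = X.D ⟨a (T x), haTx⟩ := by
    congr 1
    exact Subtype.ext (hcomm x)
  change T (commutator X.D a x) = s • commutator X.D a (T x)
  have e1' : X.D ⟨a x, hax⟩ - a (X.D ⟨x, hx⟩) = commutator X.D a x := e1
  have e4' : X.D ⟨a (T x), haTx⟩ - a (X.D ⟨T x, hTx⟩) = commutator X.D a (T x) := e4
  have e2' : T (X.D ⟨x, hx⟩) = s • X.D ⟨T x, hTx⟩ := e2
  have e3' : T (X.D ⟨a x, hax⟩) = s • X.D ⟨T (a x), hTax⟩ := e3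
  rw [← e1', ← e4', map_sub, e3', e5, hcomm, e2', map_smul, smul_sub]

lemma commutes_cliff {T : H →L[ℂ] H} (hT : IsSelfAdjoint T)
    (h0 : ∀ a ∈ X.alg, T * a = a * T)
    (h1 : ∀ a ∈ X.alg, T * commutator X.D a = commutator X.D a * T)
    {w : H →L[ℂ] H} (hw : w ∈ X.cliff) : T * w = w * T := by
  induction hw using StarAlgebra.adjoin_induction with
  | mem x hx =>
    rcases hx with hx | ⟨a, ha, rfl⟩
    · exact h0 x hx
    · exact h1 a ha
  | algebraMap r => exact (Algebra.commutes r T).symm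
  | add x y _ _ hx hy => rw [mul_add, add_mul, hx, hy]
  | mul x y _ _ hx hy => rw [← mul_assoc, hx, mul_assoc, hy, mul_assoc]
  | star x _ hx =>
    have := congrArg star hx
    rwa [star_mul, star_mul, hT.star_eq, eq_comm] at this

/-- The conjugation by a selfadjoint unitary that commutes with the algebra and anticommutes with
the commutators `[D, a]` preserves the Clifford algebra. -/
lemma conj_mem_cliff {T : H →L[ℂ] H} (hT : IsSelfAdjoint T) (hTT : T * T = 1)
    (h0 : ∀ a ∈ X.alg, T * a = a * T)
    (h1 : ∀ a ∈ X.alg, T * commutator X.D a = -(commutator X.D a * T))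
    {w : H →L[ℂ] H} (hw : w ∈ X.cliff) : T * w * T ∈ X.cliff := by
  induction hw using StarAlgebra.adjoin_induction with
  | mem x hx =>
    rcases hx with hx | ⟨a, ha, rfl⟩
    · rw [h0 x hx, mul_assoc, hTT, mul_one]
      exact X.alg_le_cliff hx
    · rw [h1 a ha, neg_mul, mul_assoc, hTT, mul_one]
      exact neg_mem (StarAlgebra.subset_adjoin ℂ _ (Or.inr ⟨a, ha, rfl⟩))
  | algebraMap r =>
    rw [← Algebra.commutes r T, mul_assoc, hTT, mul_one]
    exact algebraMap_mem _ r
  | add x y _ _ hx hy =>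
    rw [mul_add, add_mul]
    exact add_mem hx hy
  | mul x y _ _ hx hy =>
    have : T * (x * y) * T = (T * x * T) * (T * y * T) := by
      calc _ = T * x * 1 * y * T := by noncomm_ring
        _ = T * x * (T * T) * y * T := by rw [hTT]
        _ = _ := by noncomm_ring
    rw [this]
    exact mul_mem hx hy
  | star x _ hx =>
    have := star_mem hx
    rwa [star_mul, star_mul, hT.star_eq, ← mul_assoc] at this

/-- Both conjugations are *-homomorphisms that fix 𝒜 and negate every [D, a], so they agree on
generators. The case of interest is T = ε and V = C with p even. -/
lemma conj_eq_conj {T V : H →L[ℂ] H} (hT : IsSelfAdjoint T) (hTT : T * T = 1)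
    (hV : IsSelfAdjoint V) (hVV : V * V = 1)
    (h0 : ∀ a ∈ X.alg, T * a = a * T)
    (h1 : ∀ a ∈ X.alg, T * commutator X.D a = -(commutator X.D a * T))
    (k0 : ∀ a ∈ X.alg, V * a = a * V)
    (k1 : ∀ a ∈ X.alg, V * commutator X.D a = -(commutator X.D a * V))
    {w : H →L[ℂ] H} (hw : w ∈ X.cliff) : T * w * T = V * w * V := by
  induction hw using StarAlgebra.adjoin_induction with
  | mem x hx =>
    rcases hx with hx | ⟨a, ha, rfl⟩
    · rw [h0 x hx, k0 x hx, mul_assoc, hTT, mul_assoc, hVV]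
    · rw [h1 a ha, k1 a ha, neg_mul, neg_mul, mul_assoc, hTT, mul_assoc, hVV]
  | algebraMap r =>
    rw [← Algebra.commutes r T, ← Algebra.commutes r V, mul_assoc, hTT, mul_assoc, hVV]
  | add x y _ _ hx hy => rw [mul_add, add_mul, mul_add, add_mul, hx, hy]
  | mul x y _ _ hx hy =>
    have key : ∀ {Z : H →L[ℂ] H}, Z * Z = 1 → Z * (x * y) * Z = (Z * x * Z) * (Z * y * Z) := by
      intro Z hZ
      calc _ = Z * x * 1 * y * Z := by noncomm_ring
        _ = Z * x * (Z * Z) * y * Z := by rw [hZ]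
        _ = _ := by noncomm_ring
    rw [key hTT, key hVV, hx, hy]
  | star x _ hx =>
    have := congrArg star hx
    rwa [star_mul, star_mul, star_mul, star_mul, hT.star_eq, hV.star_eq, ← mul_assoc,
      ← mul_assoc] at this

lemma commutator_mem_cliff {a : H →L[ℂ] H} (ha : a ∈ X.alg) : commutator X.D a ∈ X.cliff :=
  StarAlgebra.subset_adjoin ℂ _ (Or.inr ⟨a, ha, rfl⟩)

lemma rep_mem_cliff {p : ℕ} (c : HochschildCycle X.alg p) : X.rep c ∈ X.cliff := by
  refine sum_mem fun α _ => mul_mem (X.alg_le_cliff (c.term α 0).2) (list_prod_mem fun x hx => ?_)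
  obtain ⟨i, rfl⟩ := (List.mem_ofFn' _ _).1 hx
  exact X.commutator_mem_cliff (c.term α i.succ).2

lemma list_prod_anticommute {R : Type*} [Ring R] {T : R} {l : List R}
    (h : ∀ x ∈ l, T * x = -(x * T)) : T * l.prod = (-1) ^ l.length * (l.prod * T) := by
  induction l with
  | nil => simp
  | cons x l ih =>
    have h1 := h x (List.mem_cons_self)
    have h2 := ih fun y hy => h y (List.mem_cons_of_mem x hy)
    rw [List.prod_cons, ← mul_assoc, h1, List.length_cons, neg_mul, mul_assoc, h2, pow_succ,
      mul_neg_one, neg_mul, ← mul_assoc, ← mul_assoc, ← mul_assoc,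
      ((Commute.neg_one_right x).pow_right l.length).eq]
    simp only [mul_assoc]

/-- Each term of C contains p commutators, hence an odd number of sign changes. -/
lemma anticommute_rep {p : ℕ} (hp : Odd p) (c : HochschildCycle X.alg p) {T : H →L[ℂ] H}
    (h0 : ∀ a ∈ X.alg, T * a = a * T)
    (h1 : ∀ a ∈ X.alg, T * commutator X.D a = -(commutator X.D a * T)) :
    T * X.rep c = -(X.rep c * T) := by
  unfold rep
  rw [Finset.mul_sum, Finset.sum_mul, ← Finset.sum_neg_distrib]
  refine Finset.sum_congr rfl fun α _ => ?_
  have h2 := list_prod_anticommute (T := T)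
    (l := List.ofFn fun i : Fin p => commutator X.D (c.term α i.succ : H →L[ℂ] H)) fun x hx => by
      obtain ⟨i, rfl⟩ := (List.mem_ofFn' _ _).1 hx
      exact h1 _ (c.term α i.succ).2
  rw [List.length_ofFn, hp.neg_one_pow, neg_one_mul] at h2
  rw [← mul_assoc, h0 _ (c.term α 0).2, mul_assoc, h2, mul_neg, mul_assoc]

lemma IsGrading.anticomm_commutator {X : SpectralTriple H} {ε : H →L[ℂ] H} (h : X.IsGrading ε)
    {a : H →L[ℂ] H} (ha : a ∈ X.alg) :
    ε * commutator X.D a = -(commutator X.D a * ε) := by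
  rw [X.mul_commutator_eq (s := -1) (fun x => ?_) ha (h.comm_alg a ha), neg_one_smul]
  obtain ⟨hx, e⟩ := h.anticomm_D x
  exact ⟨hx, by rw [neg_one_smul]; exact eq_neg_of_add_eq_zero_left e⟩

end SpectralTriple

end Symmetries

/-! ### The conjugation of a cyclic tracial vector. -/

section Tomita

variable {H : Type*} [NormedAddCommGroup H] [InnerProductSpace ℂ H] [CompleteSpace H]

variable {𝓑 : StarSubalgebra ℂ (H →L[ℂ] H)} {Φ : H}

/-- The orbit map `w ↦ w Φ`. -/
def orbitMap (𝓑 : StarSubalgebra ℂ (H →L[ℂ] H)) (Φ : H) : 𝓑 →ₗ[ℂ] H where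
  toFun w := (w : H →L[ℂ] H) Φ
  map_add' _ _ := rfl
  map_smul' _ _ := rfl

/-- `J (w Φ) = w* Φ` on the `*`-algebra itself. -/
def IsPreTomita (𝓑 : StarSubalgebra ℂ (H →L[ℂ] H)) (Φ : H) (J : H ≃ₗᵢ⋆[ℂ] H) : Prop :=
  ∀ w ∈ 𝓑, J (w Φ) = (star w) Φ

lemma IsTomita.isPreTomita {J : H ≃ₗᵢ⋆[ℂ] H} (h : IsTomita 𝓑 Φ J) : IsPreTomita 𝓑 Φ J :=
  fun w hw => h w (Set.subset_centralizer_centralizer hw)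

lemma inner_apply_star (w : H →L[ℂ] H) (x y : H) : inner ℂ (w x) y = inner ℂ x ((star w) y) := by
  rw [ContinuousLinearMap.star_eq_adjoint, ContinuousLinearMap.adjoint_inner_right]

/-- Traciality gives ‖w*Φ‖² = ⟨Φ|ww*Φ⟩ = ⟨Φ|w*wΦ⟩ = ‖wΦ‖², so wΦ ↦ w*Φ is well defined and
isometric, and extends by density. -/
lemma exists_isPreTomita (hd : DenseRange (orbitMap 𝓑 Φ))
    (htr : ∀ u ∈ 𝓑, ∀ v ∈ 𝓑, inner ℂ Φ ((u * v) Φ) = inner ℂ Φ ((v * u) Φ)) :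
    ∃ J : H ≃ₗᵢ⋆[ℂ] H, IsPreTomita 𝓑 Φ J := by
  have hnorm : ∀ w : 𝓑, ‖orbitMap 𝓑 Φ (starLinearEquiv ℂ w)‖ = ‖orbitMap 𝓑 Φ w‖ := by
    intro w
    have h := htr (w : H →L[ℂ] H) w.2 (star (w : H →L[ℂ] H)) (star_mem w.2)
    have h1 : inner ℂ Φ (((w : H →L[ℂ] H) * star (w : H →L[ℂ] H)) Φ) =
        inner ℂ (star (w : H →L[ℂ] H) Φ) (star (w : H →L[ℂ] H) Φ) := by
      rw [inner_apply_star, star_star]; rfl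
    have h2 : inner ℂ Φ ((star (w : H →L[ℂ] H) * (w : H →L[ℂ] H)) Φ) =
        inner ℂ ((w : H →L[ℂ] H) Φ) ((w : H →L[ℂ] H) Φ) := by
      rw [inner_apply_star]; rfl
    rw [h1, h2, inner_self_eq_ofReal, inner_self_eq_ofReal] at h
    have h3 : ‖star (w : H →L[ℂ] H) Φ‖ ^ 2 = ‖(w : H →L[ℂ] H) Φ‖ ^ 2 := by exact_mod_cast h
    exact (pow_left_inj₀ (norm_nonneg _) (norm_nonneg _) two_ne_zero).1 h3
  refine ⟨(starLinearEquiv ℂ : 𝓑 ≃ₗ⋆[ℂ] 𝓑).extendOfIsometry (orbitMap 𝓑 Φ) (orbitMap 𝓑 Φ) hd hd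
    hnorm, fun w hw => ?_⟩
  exact LinearEquiv.extendOfIsometry_eq (starLinearEquiv ℂ : 𝓑 ≃ₗ⋆[ℂ] 𝓑) (orbitMap 𝓑 Φ)
    (orbitMap 𝓑 Φ) hd hd hnorm ⟨w, hw⟩

namespace IsPreTomita

variable {J : H ≃ₗᵢ⋆[ℂ] H}

lemma involutive (h : IsPreTomita 𝓑 Φ J) (hd : DenseRange (orbitMap 𝓑 Φ)) (x : H) :
    J (J x) = x := by
  refine hd.induction_on (p := fun x => J (J x) = x) x
    (isClosed_eq (J.continuous.comp J.continuous) continuous_id) fun w => ?_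
  change J (J ((w : H →L[ℂ] H) Φ)) = (w : H →L[ℂ] H) Φ
  rw [h w w.2, h _ (star_mem w.2), star_star]

lemma inner_map_map (h : IsPreTomita 𝓑 Φ J) (hd : DenseRange (orbitMap 𝓑 Φ))
    (htr : ∀ u ∈ 𝓑, ∀ v ∈ 𝓑, inner ℂ Φ ((u * v) Φ) = inner ℂ Φ ((v * u) Φ)) (x y : H) :
    inner ℂ (J x) (J y) = inner ℂ y x := by
  have hJ := J.continuous
  refine hd.induction_on₂ (p := fun x y => inner ℂ (J x) (J y) = inner ℂ y x) ?_ ?_ x y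
  · exact isClosed_eq (by fun_prop) (by fun_prop)
  · intro u v
    change inner ℂ (J ((u : H →L[ℂ] H) Φ)) (J ((v : H →L[ℂ] H) Φ)) =
      inner ℂ ((v : H →L[ℂ] H) Φ) ((u : H →L[ℂ] H) Φ)
    rw [h u u.2, h v v.2, inner_apply_star, inner_apply_star, star_star]
    exact htr _ u.2 _ (star_mem v.2)

/-- J u* J vΦ = J(u*v*Φ) = vuΦ. The later computations with J rest on this description of u^op as
right multiplication. -/
lemma opAction_apply (h : IsPreTomita 𝓑 Φ J) {u v : H →L[ℂ] H} (hu : u ∈ 𝓑) (hv : v ∈ 𝓑) :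
    opAction J u (v Φ) = v (u Φ) := by
  change J ((star u) (J (v Φ))) = _
  rw [h v hv]
  have := h (star u * star v) (mul_mem (star_mem hu) (star_mem hv))
  rw [star_mul, star_star, star_star] at this
  exact this

lemma opAction_commute (h : IsPreTomita 𝓑 Φ J) (hd : DenseRange (orbitMap 𝓑 Φ)) {u w : H →L[ℂ] H}
    (hu : u ∈ 𝓑) (hw : w ∈ 𝓑) : w * opAction J u = opAction J u * w := by
  refine ContinuousLinearMap.coeFn_injective (hd.equalizer
    (w * opAction J u).continuous (opAction J u * w).continuous ?_)
  funext v
  change w (opAction J u ((v : H →L[ℂ] H) Φ)) = opAction J u ((w * (v : H →L[ℂ] H)) Φ)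
  rw [h.opAction_apply hu v.2, h.opAction_apply hu (mul_mem hw v.2)]
  rfl

lemma isTomita (h : IsPreTomita 𝓑 Φ J) (hd : DenseRange (orbitMap 𝓑 Φ))
    (htr : ∀ u ∈ 𝓑, ∀ v ∈ 𝓑, inner ℂ Φ ((u * v) Φ) = inner ℂ Φ ((v * u) Φ)) :
    IsTomita 𝓑 Φ J := by
  intro T hT
  have hJΦ : J Φ = Φ := by
    have := h 1 (one_mem 𝓑)
    rwa [star_one, one_apply_eq_self] at this
  refine hd.eq_of_inner_right ℂ ?_
  intro u
  change inner ℂ ((u : H →L[ℂ] H) Φ) (J (T Φ)) = inner ℂ ((u : H →L[ℂ] H) Φ) (star T Φ)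
  -- u^op lies in the commutant of 𝓑, and T in the double commutant.
  have hc : T * opAction J (u : H →L[ℂ] H) = opAction J u * T := by
    refine (hT _ ?_).symm
    intro w hw
    exact h.opAction_commute hd u.2 hw
  have h1 : (u : H →L[ℂ] H) Φ = opAction J u Φ := by
    have := h.opAction_apply u.2 (one_mem 𝓑)
    exact this.symm
  have h2 : T (opAction J (u : H →L[ℂ] H) Φ) = J ((star (u : H →L[ℂ] H)) (J (T Φ))) :=
    congrArg (fun A : H →L[ℂ] H => A Φ) hc
  -- The right side is ⟨TuΦ|Φ⟩ with TuΦ = Tu^opΦ = J u* J TΦ; antiunitarity and JΦ = Φ turn it into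
  -- the left side.
  rw [← inner_apply_star T]
  nth_rw 2 [h1]
  rw [h2]
  nth_rw 4 [← hJΦ]
  rw [h.inner_map_map hd htr, inner_apply_star]

end IsPreTomita

end Tomita

/-! ### Two facts on C*-algebras for the bounds and for fullness. -/

section PreMorita

/-- A positive element `z` that commutes with `a`, compressed by `u a`. -/
lemma conj_le_norm_sq_smul_conj {A : Type*} [CStarAlgebra A] [PartialOrder A] [StarOrderedRing A]
    {z a : A} (hz : 0 ≤ z) (h : Commute z a) (h' : Commute z (star a)) (u : A) :
    u * a * z * star (u * a) ≤ ‖a‖ ^ 2 • (u * z * star u) := by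
  -- The difference of the two sides is u(‖a‖² − aa*)zu*, a compression of a product of commuting
  -- positive elements.
  have h1 : 0 ≤ algebraMap ℝ A (‖a‖ ^ 2) - a * star a :=
    sub_nonneg.2 CStarAlgebra.mul_star_le_algebraMap_norm_sq
  have hc : Commute (algebraMap ℝ A (‖a‖ ^ 2) - a * star a) z :=
    (Algebra.commute_algebraMap_left _ z).sub_left (h.mul_right h').symm
  have h2 := star_right_conjugate_nonneg (Commute.mul_nonneg h1 hz hc) u
  rw [← sub_nonneg]
  convert h2 using 1
  rw [sub_mul, mul_sub, sub_mul, Algebra.algebraMap_eq_smul_one, smul_one_mul, mul_smul_comm,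
    smul_mul_assoc, star_mul, mul_assoc a, ← h'.eq]
  noncomm_ring

/-- Spectral permanence: the inverse of z lies in the closure of 𝓑, hence is a norm limit of
elements of 𝓑. -/
lemma exists_seq_tendsto_inverse {A : Type*} [CStarAlgebra A] (𝓑 : StarSubalgebra ℂ A) {z : A}
    (hz : z ∈ 𝓑) (hu : IsUnit z) {δ : ℝ} (hδ : 0 < δ) :
    ∃ v ∈ 𝓑, ‖v * z - 1‖ < δ := by
  set S := 𝓑.topologicalClosure
  have hS : IsClosed (S : Set A) := 𝓑.isClosed_topologicalClosure
  have hzS : z ∈ S := 𝓑.le_topologicalClosure hz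
  obtain ⟨y, hy⟩ := (StarSubalgebra.coe_isUnit S (a := ⟨z, hzS⟩)).1 hu |>.exists_left_inv
  have hyz : (y : A) * z = 1 := congrArg Subtype.val hy
  have hycl : (y : A) ∈ closure (𝓑 : Set A) := by
    rw [← StarSubalgebra.topologicalClosure_coe]; exact y.2
  have hcont : ContinuousAt (fun v : A => ‖v * z - 1‖) (y : A) := by fun_prop
  have h0 : ‖(y : A) * z - 1‖ < δ := by rw [hyz]; simpa using hδ
  obtain ⟨v, hv1, hv2⟩ := mem_closure_iff_nhds.1 hycl _ (hcont.eventually_lt_const h0)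
  exact ⟨v, hv2, hv1⟩

variable {H : Type*} [NormedAddCommGroup H] [InnerProductSpace ℂ H] [CompleteSpace H]

/-! ### The conjugation J, the operators ε and C, and the bimodule H_∞. -/

namespace SpectralTriple.RiemannianStructure

variable {X : SpectralTriple H} {ω : DixmierLimit} {p : ℕ} (R : X.RiemannianStructure ω p)

lemma exists_leftAction_eq (ξ : X.Hinf) : ∃ w : X.cliff, R.leftAction w R.Φ = ξ := by
  obtain ⟨w, hw, e⟩ := (R.cyclic ξ).1 ξ.2
  exact ⟨⟨w, hw⟩, Subtype.ext e⟩

lemma leftAction_leftAction (u v : X.cliff) (ξ : X.Hinf) :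
    R.leftAction u (R.leftAction v ξ) = R.leftAction (u * v) ξ := by
  rw [map_mul]; rfl

lemma pairing_leftAction (u v : X.cliff) :
    R.pairing (R.leftAction u R.Φ) (R.leftAction v R.Φ) =
      u * R.pairing R.Φ R.Φ * star v :=
  R.hermitian.act u v R.Φ R.Φ

lemma denseRange_orbitMap : DenseRange (orbitMap X.cliff (R.Φ : H)) := by
  have h := dense_smoothDom X.selfAdjoint X.compact_regInv
  refine h.mono fun ξ hξ => ?_
  obtain ⟨w, hw, e⟩ := (R.cyclic ξ).1 hξ
  exact ⟨⟨w, hw⟩, e⟩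

lemma inner_Φ_apply {w : H →L[ℂ] H} (hw : w ∈ X.cliff) :
    inner ℂ (R.Φ : H) (w R.Φ) = X.psi ω p (w * (R.pairing R.Φ R.Φ : H →L[ℂ] H)) := by
  have h := R.inner_eq (R.leftAction ⟨w, hw⟩ R.Φ) R.Φ
  have h1 := R.hermitian.act ⟨w, hw⟩ 1 R.Φ R.Φ
  have h2 : restrictAction X.cliff X.Hinf R.cyclic.invariant 1 R.Φ = R.Φ := rfl
  rw [star_one, mul_one, h2] at h1
  have h3 : R.pairing (R.leftAction ⟨w, hw⟩ R.Φ) R.Φ = ⟨w, hw⟩ * R.pairing R.Φ R.Φ := h1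
  rw [h3] at h
  exact h

/-- The vector state of `Φ` is a trace on the Clifford algebra. -/
lemma inner_Φ_mul_comm (hreg : X.IsQCInfty) (hp : 0 < p) (hsum : X.IsZpSummable p) :
    ∀ u ∈ X.cliff, ∀ v ∈ X.cliff,
      inner ℂ (R.Φ : H) ((u * v) R.Φ) = inner ℂ (R.Φ : H) ((v * u) R.Φ) := by
  intro u hu v hv
  have hz : u * (R.pairing R.Φ R.Φ : H →L[ℂ] H) = (R.pairing R.Φ R.Φ : H →L[ℂ] H) * u :=
    congrArg Subtype.val (R.central ⟨u, hu⟩)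
  -- ψ(uvz) = ψ(vzu) = ψ(vuz), by the trace property and then centrality of z.
  rw [R.inner_Φ_apply (mul_mem hu hv), R.inner_Φ_apply (mul_mem hv hu), mul_assoc,
    X.psi_mul_comm hreg hp hsum ω u (mul_mem hv (R.pairing R.Φ R.Φ).2), mul_assoc, mul_assoc, hz]

lemma existsUnique_isTomita (hreg : X.IsQCInfty) (hp : 0 < p) (hsum : X.IsZpSummable p) :
    ∃! J : H ≃ₗᵢ⋆[ℂ] H, IsTomita X.cliff R.Φ J := by
  have hd := R.denseRange_orbitMap
  have htr := R.inner_Φ_mul_comm hreg hp hsum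
  obtain ⟨J, hJ⟩ := exists_isPreTomita hd htr
  refine ⟨J, hJ.isTomita hd htr, fun J' hJ' => ?_⟩
  refine LinearIsometryEquiv.ext fun x => ?_
  refine congrFun (hd.equalizer J'.continuous J.continuous ?_) x
  funext w
  exact (hJ'.isPreTomita w w.2).trans (hJ w w.2).symm

variable {R} {J : H ≃ₗᵢ⋆[ℂ] H}

lemma apply_mem_Hinf (hJ : IsPreTomita X.cliff (R.Φ : H) J) {ξ : H} (hξ : ξ ∈ X.Hinf) :
    J ξ ∈ X.Hinf := by
  obtain ⟨w, hw, rfl⟩ := (R.cyclic ξ).1 hξ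
  rw [hJ w hw]
  exact (R.cyclic _).2 ⟨star w, star_mem hw, rfl⟩

/-- Two bounded operators that agree on the orbit of `Φ` are equal. -/
lemma eq_of_orbit {f g : H → H} (hf : Continuous f) (hg : Continuous g)
    (h : ∀ w ∈ X.cliff, f (w R.Φ) = g (w R.Φ)) : f = g :=
  R.denseRange_orbitMap.equalizer hf hg (funext fun w => h w w.2)

/-- Since εΦ = Φ, ε acts on the orbit as w ↦ εwε, which preserves 𝒞 and commutes with the
involution. -/
lemma J_ε (hJ : IsPreTomita X.cliff (R.Φ : H) J) (ξ : H) : J (R.ε ξ) = R.ε (J ξ) := by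
  refine congrFun (eq_of_orbit (R := R) (f := fun ξ => J (R.ε ξ)) (g := fun ξ => R.ε (J ξ))
    (J.continuous.comp R.ε.continuous) (R.ε.continuous.comp J.continuous) fun w hw => ?_) ξ
  have hα := X.conj_mem_cliff R.grading.selfAdjoint R.grading.sq_eq_one R.grading.comm_alg
    (fun a ha => R.grading.anticomm_commutator ha) hw
  have h1 : ∀ v : H →L[ℂ] H, R.ε (v R.Φ) = (R.ε * v * R.ε) R.Φ := fun v => by
    change _ = R.ε (v (R.ε R.Φ))
    rw [R.grading_Φ]
  change J (R.ε (w R.Φ)) = R.ε (J (w R.Φ))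
  rw [h1, hJ _ hα, hJ w hw, h1, star_mul, star_mul, R.grading.selfAdjoint.star_eq, mul_assoc]

lemma comp_J_comp_J_apply (hJ : IsPreTomita X.cliff (R.Φ : H) J) {C : H →L[ℂ] H}
    (hC : C ∈ X.cliff) (hsa : IsSelfAdjoint C) {w : H →L[ℂ] H} (hw : w ∈ X.cliff) :
    J (C (J (w R.Φ))) = (w * C) R.Φ := by
  rw [hJ w hw]
  have := hJ (C * star w) (mul_mem hC (star_mem hw))
  rw [star_mul, star_star, hsa.star_eq] at this
  exact this

/-- For p even C anticommutes with D, so C and ε induce the same conjugation on 𝒞 and εwΦ = CwCΦ;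
the right factor C is the action of JCJ. -/
lemma ε_apply_of_even (hp : Even p) (hJ : IsPreTomita X.cliff (R.Φ : H) J)
    {c : HochschildCycle X.alg p} (hc : X.IsOrientation c) (ξ : H) :
    R.ε ξ = X.rep c (J (X.rep c (J ξ))) := by
  refine congrFun (eq_of_orbit (R := R) (f := R.ε) (g := fun ξ => X.rep c (J (X.rep c (J ξ))))
    R.ε.continuous ((X.rep c).continuous.comp (J.continuous.comp
      ((X.rep c).continuous.comp J.continuous))) fun w hw => ?_) ξ
  have hanti : ∀ a ∈ X.alg, X.rep c * commutator X.D a = -(commutator X.D a * X.rep c) := by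
    intro a ha
    rw [X.mul_commutator_eq (s := -1) (fun x => ?_) ha (hc.comm_alg a ha), neg_one_smul]
    obtain ⟨hx, e⟩ := hc.comm_D x
    refine ⟨hx, ?_⟩
    rw [e, hp.add_one.neg_one_pow]
  have h := X.conj_eq_conj R.grading.selfAdjoint R.grading.sq_eq_one hc.selfAdjoint hc.sq_eq_one
    R.grading.comm_alg (fun a ha => R.grading.anticomm_commutator ha) hc.comm_alg hanti hw
  have h1 : R.ε (w R.Φ) = (R.ε * w * R.ε) R.Φ := by
    change _ = R.ε (w (R.ε R.Φ))
    rw [R.grading_Φ]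
  change R.ε (w R.Φ) = X.rep c (J (X.rep c (J (w R.Φ))))
  rw [comp_J_comp_J_apply hJ (X.rep_mem_cliff c) hc.selfAdjoint hw, h1, h, mul_assoc]
  rfl

/-- For p odd C commutes with D, hence with every [D, a], and is central in 𝒞: its left and right
multiplications agree on the orbit. -/
lemma rep_apply_of_odd (hp : Odd p) (hJ : IsPreTomita X.cliff (R.Φ : H) J)
    {c : HochschildCycle X.alg p} (hc : X.IsOrientation c) (ξ : H) :
    X.rep c ξ = J (X.rep c (J ξ)) := by
  refine congrFun (eq_of_orbit (R := R) (f := X.rep c) (g := fun ξ => J (X.rep c (J ξ)))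
    (X.rep c).continuous (J.continuous.comp
      ((X.rep c).continuous.comp J.continuous)) fun w hw => ?_) ξ
  have hcomm : ∀ a ∈ X.alg, X.rep c * commutator X.D a = commutator X.D a * X.rep c := by
    intro a ha
    rw [X.mul_commutator_eq (s := 1) (fun x => ?_) ha (hc.comm_alg a ha), one_smul]
    obtain ⟨hx, e⟩ := hc.comm_D x
    refine ⟨hx, ?_⟩
    rw [e, hp.add_one.neg_one_pow]
  have h := X.commutes_cliff hc.selfAdjoint hc.comm_alg hcomm hw
  change X.rep c (w R.Φ) = J (X.rep c (J (w R.Φ)))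
  rw [comp_J_comp_J_apply hJ (X.rep_mem_cliff c) hc.selfAdjoint hw, ← h]
  rfl

lemma bijOn_Hinf (hJ : IsPreTomita X.cliff (R.Φ : H) J) :
    Set.BijOn J (X.Hinf : Set H) (X.Hinf : Set H) :=
  ⟨fun _ hξ => apply_mem_Hinf hJ hξ, J.injective.injOn, fun ξ hξ =>
    ⟨J ξ, apply_mem_Hinf hJ hξ, hJ.involutive R.denseRange_orbitMap ξ⟩⟩

/-- The restriction of `J` to the smooth domain. -/
def smoothJ (hJ : IsPreTomita X.cliff (R.Φ : H) J) (ξ : X.Hinf) : X.Hinf :=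
  ⟨J ξ, apply_mem_Hinf hJ ξ.2⟩

lemma smoothJ_leftAction (hJ : IsPreTomita X.cliff (R.Φ : H) J) (w : X.cliff) :
    smoothJ hJ (R.leftAction w R.Φ) = R.leftAction (star w) R.Φ :=
  Subtype.ext (hJ w w.2)

lemma opAction_mem_Hinf (hJ : IsPreTomita X.cliff (R.Φ : H) J) {w : H →L[ℂ] H} (hw : w ∈ X.cliff)
    {ξ : H} (hξ : ξ ∈ X.Hinf) : opAction J w ξ ∈ X.Hinf :=
  apply_mem_Hinf hJ (R.cyclic.invariant _ (star_mem hw) _ (apply_mem_Hinf hJ hξ))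

/-- The right action `ξ ↦ J w* J ξ` of an element of the Clifford algebra. -/
def rightMul (hJ : IsPreTomita X.cliff (R.Φ : H) J) (w : X.cliff) : Module.End ℂ X.Hinf :=
  (opAction J (w : H →L[ℂ] H)).toLinearMap.restrict fun _ hξ => opAction_mem_Hinf hJ w.2 hξ

lemma rightMul_leftAction (hJ : IsPreTomita X.cliff (R.Φ : H) J) (w u : X.cliff) :
    rightMul hJ w (R.leftAction u R.Φ) = R.leftAction (u * w) R.Φ :=
  Subtype.ext (hJ.opAction_apply w.2 u.2)

lemma end_ext {S T : Module.End ℂ X.Hinf}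
    (h : ∀ u, S (R.leftAction u R.Φ) = T (R.leftAction u R.Φ)) : S = T := by
  refine LinearMap.ext fun ξ => ?_
  obtain ⟨u, rfl⟩ := R.exists_leftAction_eq ξ
  exact h u

/-- The right action of the Clifford algebra on the smooth domain. -/
def rightAction (hJ : IsPreTomita X.cliff (R.Φ : H) J) :
    X.cliffᵐᵒᵖ →ₐ[ℂ] Module.End ℂ X.Hinf where
  toFun w := rightMul hJ w.unop
  map_one' := end_ext (R := R) fun u => by
    rw [rightMul_leftAction, MulOpposite.unop_one, mul_one]; rfl
  map_mul' v w := end_ext (R := R) fun u => by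
    rw [rightMul_leftAction, MulOpposite.unop_mul, ← mul_assoc, Module.End.mul_apply,
      rightMul_leftAction, rightMul_leftAction]
  map_zero' := end_ext (R := R) fun u => by
    rw [rightMul_leftAction, MulOpposite.unop_zero, mul_zero, map_zero]; rfl
  map_add' v w := end_ext (R := R) fun u => by
    rw [rightMul_leftAction, MulOpposite.unop_add, mul_add, map_add, LinearMap.add_apply,
      LinearMap.add_apply, rightMul_leftAction, rightMul_leftAction]
  commutes' r := end_ext (R := R) fun u => by
    rw [rightMul_leftAction, MulOpposite.algebraMap_apply, MulOpposite.unop_op,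
      ← Algebra.commutes r u, map_mul, AlgHom.commutes]
    rfl

lemma rightAction_leftAction (hJ : IsPreTomita X.cliff (R.Φ : H) J) (w u : X.cliff) :
    rightAction hJ (.op w) (R.leftAction u R.Φ) = R.leftAction (u * w) R.Φ :=
  rightMul_leftAction hJ w u

-- If v in 𝒞 approximates the inverse of z, then wvz approximates w. The abstract pairing lets one
-- argument serve both sides.
variable (R) in
lemma isFull_of_forall {pair : X.Hinf → X.Hinf → X.cliff}
    (h : ∀ u v : X.cliff, ∃ e f, pair e f = u * R.pairing R.Φ R.Φ * star v) :
    IsFull X.cliff pair := by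
  intro w
  refine Metric.mem_closure_iff.2 fun δ hδ => ?_
  obtain ⟨v, hv, hvz⟩ := exists_seq_tendsto_inverse X.cliff (R.pairing R.Φ R.Φ).2
    R.strictlyPositive.isUnit (δ := δ / (‖(w : H →L[ℂ] H)‖ + 1)) (by positivity)
  obtain ⟨e, f, hef⟩ := h (w * ⟨v, hv⟩) 1
  refine ⟨pair e f, Submodule.subset_span ⟨e, f, rfl⟩, ?_⟩
  rw [dist_comm, hef, star_one, mul_one, Subtype.dist_eq, dist_eq_norm]
  have e1 : (((w * ⟨v, hv⟩ * R.pairing R.Φ R.Φ : X.cliff) : H →L[ℂ] H) - w) =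
      (w : H →L[ℂ] H) * (v * (R.pairing R.Φ R.Φ : H →L[ℂ] H) - 1) := by
    rw [mul_sub, mul_one, ← mul_assoc]; rfl
  rw [e1]
  calc _ ≤ ‖(w : H →L[ℂ] H)‖ * ‖v * (R.pairing R.Φ R.Φ : H →L[ℂ] H) - 1‖ := norm_mul_le _ _
    _ ≤ ‖(w : H →L[ℂ] H)‖ * (δ / (‖(w : H →L[ℂ] H)‖ + 1)) := by gcongr
    _ < (‖(w : H →L[ℂ] H)‖ + 1) * (δ / (‖(w : H →L[ℂ] H)‖ + 1)) := by
        gcongr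
        exact lt_add_one _
    _ = δ := by field_simp

lemma pairing_rightAction_le (w u : X.cliff) :
    ((u * w * R.pairing R.Φ R.Φ * star (u * w) : X.cliff) : H →L[ℂ] H) ≤
      ‖w‖ ^ 2 • ((u * R.pairing R.Φ R.Φ * star u : X.cliff) : H →L[ℂ] H) := by
  have hz : ∀ v : X.cliff, Commute (R.pairing R.Φ R.Φ : H →L[ℂ] H) (v : H →L[ℂ] H) := fun v =>
    (congrArg Subtype.val (R.central v)).symm
  exact conj_le_norm_sq_smul_conj (R.hermitian.nonneg R.Φ) (hz w) (hz (star w)) (u : H →L[ℂ] H)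

/-- The left pairing is antilinear in its second entry; composed with the antilinear J it becomes
linear there. On the orbit the pairing is (uΦ|vΦ) = u*zv. -/
lemma isRightHermitian (hJ : IsPreTomita X.cliff (R.Φ : H) J) :
    IsRightHermitian X.cliff (rightAction hJ)
      (fun ξ η => R.pairing (smoothJ hJ ξ) (smoothJ hJ η)) where
  add_right e f f' := by
    have h : smoothJ hJ (f + f') = smoothJ hJ f + smoothJ hJ f' :=
      Subtype.ext (map_add J (f : H) (f' : H))
    have hl := R.hermitian.add_left (smoothJ hJ f) (smoothJ hJ f') (smoothJ hJ e)
    have := congrArg star hl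
    rw [star_add, R.hermitian.star_pair, R.hermitian.star_pair, R.hermitian.star_pair] at this
    simpa only [h] using this
  smul_right c e f := by
    have h : smoothJ hJ (c • f) = star c • smoothJ hJ f :=
      Subtype.ext (map_smulₛₗ J c (f : H))
    have hl := R.hermitian.smul_left (star c) (smoothJ hJ f) (smoothJ hJ e)
    have := congrArg star hl
    rw [star_smul, star_star, R.hermitian.star_pair, R.hermitian.star_pair] at this
    simpa only [h] using this
  star_pair e f := R.hermitian.star_pair _ _
  act a b e f := by
    obtain ⟨u, rfl⟩ := R.exists_leftAction_eq e
    obtain ⟨v, rfl⟩ := R.exists_leftAction_eq f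
    simp only [rightAction_leftAction, smoothJ_leftAction, pairing_leftAction, star_mul, star_star,
      mul_assoc]
  nonneg e := R.hermitian.nonneg _
  definite e he := by
    have h1 := R.hermitian.definite _ he
    have h2 : J (e : H) = 0 := congrArg Subtype.val h1
    exact Subtype.ext (by simpa using h2)

lemma isPreMorita (hJ : IsPreTomita X.cliff (R.Φ : H) J) :
    IsPreMorita X.cliff X.cliff R.leftAction (rightAction hJ) R.pairing
      (fun ξ η => R.pairing (smoothJ hJ ξ) (smoothJ hJ η)) where
  bimodule b a e := by
    obtain ⟨u, rfl⟩ := R.exists_leftAction_eq e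
    rw [rightAction_leftAction, leftAction_leftAction, leftAction_leftAction,
      rightAction_leftAction, mul_assoc]
  left_hermitian := R.hermitian
  right_hermitian := isRightHermitian hJ
  left_full := R.isFull_of_forall fun u v => ⟨_, _, R.pairing_leftAction u v⟩
  right_full := R.isFull_of_forall fun u v =>
    ⟨R.leftAction (star u) R.Φ, R.leftAction (star v) R.Φ, by
      simp only [smoothJ_leftAction, star_star, pairing_leftAction]⟩
  left_bound a e := by
    obtain ⟨u, rfl⟩ := R.exists_leftAction_eq e
    rw [rightAction_leftAction, pairing_leftAction, pairing_leftAction]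
    exact pairing_rightAction_le a u
  right_bound b e := by
    obtain ⟨u, rfl⟩ := R.exists_leftAction_eq e
    rw [leftAction_leftAction, smoothJ_leftAction, smoothJ_leftAction, pairing_leftAction,
      pairing_leftAction, star_mul]
    -- J turns left multiplication by b into right multiplication by b*, which has the same norm.
    have h := pairing_rightAction_le (R := R) (star b) (star u)
    rwa [norm_star] at h
  compat e f g := by
    obtain ⟨u, rfl⟩ := R.exists_leftAction_eq e
    obtain ⟨v, rfl⟩ := R.exists_leftAction_eq f
    obtain ⟨w, rfl⟩ := R.exists_leftAction_eq g
    -- The two sides are uzv*wΦ and uv*zwΦ, equal because z is central.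
    rw [smoothJ_leftAction, smoothJ_leftAction, pairing_leftAction, pairing_leftAction,
      rightAction_leftAction, leftAction_leftAction, star_star, mul_assoc u,
      ← R.central (star v)]
    simp only [mul_assoc]

end SpectralTriple.RiemannianStructure

end PreMorita

end NCG

end

/-! ### Assembly of the statement. -/

theorem mainTheorem8 {H : Type*} [NormedAddCommGroup H] [InnerProductSpace ℂ H] [CompleteSpace H]
    (X : NCG.SpectralTriple H) (hreg : X.IsQCInfty)
    (p : ℕ) (hp : 0 < p) (hsum : X.IsZpSummable p) (ω : NCG.DixmierLimit)
    (c : NCG.HochschildCycle X.alg p) (hc : X.IsOrientation c)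
    (R : X.RiemannianStructure ω p) :
    (∃! J : H ≃ₗᵢ⋆[ℂ] H, NCG.IsTomita X.cliff R.Φ J) ∧
    ∀ J : H ≃ₗᵢ⋆[ℂ] H, NCG.IsTomita X.cliff R.Φ J →
      (∀ ξ, J (R.ε ξ) = R.ε (J ξ)) ∧
      (Even p → (∀ ξ, R.ε ξ = X.rep c (J (X.rep c (J ξ)))) ∧
        R.ε = X.rep c * NCG.opAction J (X.rep c)) ∧
      (Odd p → R.ε * X.rep c = -(X.rep c * R.ε) ∧
        (∀ ξ, X.rep c ξ = J (X.rep c (J ξ))) ∧ X.rep c = NCG.opAction J (X.rep c)) ∧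
      Set.BijOn J (X.Hinf : Set H) (X.Hinf : Set H) ∧
      ∃ (ract : X.cliffᵐᵒᵖ →ₐ[ℂ] Module.End ℂ X.Hinf) (Jinf : X.Hinf → X.Hinf),
        (∀ (w : X.cliff) (ξ : X.Hinf), (ract (.op w) ξ : H) = NCG.opAction J w ξ) ∧
        (∀ ξ, (Jinf ξ : H) = J ξ) ∧
        NCG.IsPreMorita X.cliff X.cliff R.leftAction ract R.pairing
          (fun ξ η => R.pairing (Jinf ξ) (Jinf η)) := by
  refine ⟨R.existsUnique_isTomita hreg hp hsum, fun J hT => ?_⟩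
  have hJ := hT.isPreTomita
  refine ⟨NCG.SpectralTriple.RiemannianStructure.J_ε hJ, fun he => ?_, fun ho => ?_,
    NCG.SpectralTriple.RiemannianStructure.bijOn_Hinf hJ,
    NCG.SpectralTriple.RiemannianStructure.rightAction hJ,
    NCG.SpectralTriple.RiemannianStructure.smoothJ hJ, fun _ _ => rfl, fun _ => rfl,
    NCG.SpectralTriple.RiemannianStructure.isPreMorita hJ⟩
  · have h := NCG.SpectralTriple.RiemannianStructure.ε_apply_of_even he hJ hc
    refine ⟨h, ContinuousLinearMap.ext fun ξ => ?_⟩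
    rw [h ξ, NCG.opAction, hc.selfAdjoint.star_eq]
    rfl
  · have h := NCG.SpectralTriple.RiemannianStructure.rep_apply_of_odd ho hJ hc
    refine ⟨X.anticommute_rep ho c R.grading.comm_alg
      (fun a ha => R.grading.anticomm_commutator ha), h, ContinuousLinearMap.ext fun ξ => ?_⟩
    rw [h ξ, NCG.opAction, hc.selfAdjoint.star_eq]
    rfl
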